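/- **Setting.** States are $\mathbf U=(\rho,\mathbf m,\mathbf B,E)\in\mathbb R^8$ with $\mathbf m,\mathbf B\in\mathbb R^3$, $\mathbf v=\mathbf m/\rho$, $\mathcal E(\mathbf U)=E-\frac{|\mathbf m|^2}{2\rho}-\frac{|\mathbf B|^2}{2}=\rho e$, and $G=\{\mathbf U:\rho>0,\ \mathcal E(\mathbf U)>0\}$. The pressure is $p=p(\rho,e)$, where, for $\rho>0$, $p(\rho,e)>0\Leftrightarrow e>0$. The ideal MHD fluxes are $$\mathbf F_i(\mathbf U)=\big(\rho v_i,\; v_i\mathbf m-B_i\mathbf B+(p+\tfrac12|\mathbf B|^2)\mathbf e_i,\; v_i\mathbf B-B_i\mathbf v,\; v_i(E+p+\tfrac12|\mathbf B|^2)-B_i(\mathbf v\cdot\mathbf B)\big),$$ and $\mathbf S(\mathbf U)=(0,\mathbf B,\mathbf v,\mathbf v\cdot\mathbf B)$. For $\mathbf U,\tilde{\mathbf U}\in G$ put $$\alpha_i(\mathbf U,\tilde{\mathbf U})=\max\Big\{|v_i|+\mathcal C_i,\ |\tilde v_i|+\tilde{\mathcal C}_i,\ \tfrac{|\sqrt\rho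 v_i+\sqrt{\tilde\rho}\tilde v_i|}{\sqrt\rho+\sqrt{\tilde\rho}}+\max\{\mathcal C_i,\tilde{\mathcal C}_i\}\Big\}+\tfrac{|\mathbf B-\tilde{\mathbf B}|}{\sqrt\rho+\sqrt{\tilde\rho}},$$ $$\mathcal C_i=\tfrac1{\sqrt2}\Big[\tfrac{|\mathbf B|^2}\rho+\mathcal C_s^2+\sqrt{\big(\tfrac{|\mathbf B|^2}\rho+\mathcal C_s^2\big)^2-4\tfrac{B_i^2\mathcal C_s^2}\rho}\Big]^{1/2},\qquad \mathcal C_s=\frac{p}{\rho\sqrt{2e}}.$$ **Meshes and solutions.** Let $x_s=x_0+s\Delta x$, $y_s=y_0+s\Delta y$ with $\Delta x,\Delta y>0$. The primal cells are $I_{ij}=(x_{i-1/2},x_{i+1/2})\times(y_{j-1/2},y_{j+1/2})$ and the dual cells are $I_{i+1/2,j+1/2}=(x_i,x_{i+1})\times(y_j,y_{j+1})$; the computation uses finitely many primal and finitely many dual cells. Let $\mathbf U_h^C$ (on the primal mesh) and $\mathbf U_h^D$ (on the dual mesh) be piecewise polynomial of total degree at most $k$ in each component on each cell, with $\partial_xB_1+\partial_yB_2=0$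 inside each cell. Each cell $I$ of one mesh, with centre $(x_c,y_d)$ ($c,d$ both integers or both half-integers), consists of four quarters lying in four cells of the other mesh. On the half intervals centred at $x_{c\pm1/4}$ and $y_{d\pm1/4}$ (of lengths $\Delta x/2$ and $\Delta y/2$) let $x^{(\mu)}_{c\pm1/4},y^{(\mu)}_{d\pm1/4}$ be the $N=k+1$ Gauss points, with weights $\omega_\mu$, $\sum_\mu\omega_\mu=1$, and let $\hat x^{(\nu)}_{c\pm1/4},\hat y^{(\nu)}_{d\pm1/4}$ be the $L=\lceil\frac{k+3}2\rceil$ Gauss–Lobatto points, with weights $\hat\omega_\nu$, $\sum_\nu\hat\omega_\nu=1$. **Scheme.** For a cell $I$ as above write $\overline{\mathbf U}$ for the average over $I$ of the solution of its own mesh, $\mathbf V$ for the solution of the other mesh, with magnetic field $(B_1,B_2,B_3)$, and $\overline{\mathbf V}$ for the average of $\mathbf V$ over $I$. On the mid-lines $x=x_c$ and $y=y_d$ of $I$, where $\mathbf V$ may be discontinuous, $[\![\cdot]\!]$ is the jump (right minus left limit, resp. upper minus lower limit) and $\{\!\{\cdot\}\!\}$ is the arithmetic mean of the two one-sided limits.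 For a given $\tau_{\max}>0$ set $$\begin{aligned}\mathcal L^{\rm new}_I={}&\frac{\overline{\mathbf V}-\overline{\mathbf U}}{\tau_{\max}}-\frac1{\Delta x}\sum_{\sigma=\pm1}\sum_{\mu=1}^N\frac{\omega_\mu}2\Big(\mathbf F_1(\mathbf V(x_{c+\frac12},y^{(\mu)}_{d+\frac\sigma4}))-\mathbf F_1(\mathbf V(x_{c-\frac12},y^{(\mu)}_{d+\frac\sigma4}))\Big)\\&-\frac1{\Delta y}\sum_{\sigma=\pm1}\sum_{\mu=1}^N\frac{\omega_\mu}2\Big(\mathbf F_2(\mathbf V(x^{(\mu)}_{c+\frac\sigma4},y_{d+\frac12}))-\mathbf F_2(\mathbf V(x^{(\mu)}_{c+\frac\sigma4},y_{d-\frac12}))\Big)\\&-\sum_{\sigma=\pm1}\sum_{\mu=1}^N\frac{\omega_\mu}2\Big(\frac{[\![B_1(x_c,y^{(\mu)}_{d+\frac\sigma4})]\!]}{\Delta x}\mathbf S\big(\{\!\{\mathbf V(x_c,y^{(\mu)}_{d+\frac\sigma4})\}\!\}\big)+\frac{[\![B_2(x^{(\mu)}_{c+\frac\sigma4},y_d)]\!]}{\Delta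 y}\mathbf S\big(\{\!\{\mathbf V(x^{(\mu)}_{c+\frac\sigma4},y_d)\}\!\}\big)\Big).\end{aligned}$$ **Speeds.** With maxima over all cells $I$ of both meshes, all $\mu$ and $\sigma=\pm1$, let $$\hat a_1=\max\alpha_1\big(\mathbf V(x_{c+\frac12},y^{(\mu)}_{d+\frac\sigma4}),\mathbf V(x_{c-\frac12},y^{(\mu)}_{d+\frac\sigma4})\big),\qquad \beta_1=\max\frac{\big|[\![B_1(x_c,y^{(\mu)}_{d+\frac\sigma4})]\!]\big|}{2\sqrt{\{\!\{\rho(x_c,y^{(\mu)}_{d+\frac\sigma4})\}\!\}}},$$ $$\hat a_2=\max\alpha_2\big(\mathbf V(x^{(\mu)}_{c+\frac\sigma4},y_{d+\frac12}),\mathbf V(x^{(\mu)}_{c+\frac\sigma4},y_{d-\frac12})\big),\qquad \beta_2=\max\frac{\big|[\![B_2(x^{(\mu)}_{c+\frac\sigma4},y_d)]\!]\big|}{2\sqrt{\{\!\{\rho(x^{(\mu)}_{c+\frac\sigma4},y_d)\}\!\}}},$$ where $\rho$ is the density component of $\mathbf V$, and put $a_\ell=\max\{\hat a_\ell,\beta_\ell\}$,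 $\ell=1,2$. **Theorem (PP property of the new locally DF CDG method).** Assume that for every cell of either mesh the average $\overline{\mathbf U}$ is in $G$, and that in every cell of either mesh $\mathbf V$ takes values in $G$ at all points $(\hat x^{(\nu)}_{c\pm\frac14},y^{(\mu)}_{d\pm\frac14})$ and $(x^{(\mu)}_{c\pm\frac14},\hat y^{(\nu)}_{d\pm\frac14})$ (all combinations of signs; for points on a mid-line, both one-sided limits are in $G$). Let $\Delta t>0$ and $\theta=\Delta t/\tau_{\max}\in(0,1]$. If $$\frac{a_1\Delta t}{\Delta x}+\frac{a_2\Delta t}{\Delta y}<\frac{\theta\hat\omega_1}2,$$ then $\overline{\mathbf U}+\Delta t\,\mathcal L^{\rm new}_I\in G$ for every cell $I$ of the primal mesh and every cell $I$ of the dual mesh. -/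

import Mathlib

noncomputable section

namespace MHD

open MeasureTheory

/-! ### States, admissible set, fluxes and source vector of ideal MHD -/

/-- Conservative vector `U = (ρ, m₁, m₂, m₃, B₁, B₂, B₃, E)`. -/
abbrev State := Fin 8 → ℝ

def density (U : State) : ℝ := U 0

def momentum (U : State) : Fin 3 → ℝ := ![U 1, U 2, U 3]

def magnetic (U : State) : Fin 3 → ℝ := ![U 4, U 5, U 6]

def energy (U : State) : ℝ := U 7

def velocity (U : State) : Fin 3 → ℝ := fun i => momentum U i / density U

/-- Euclidean scalar product on `ℝ³`. -/
def dot (a b : Fin 3 → ℝ) : ℝ := ∑ i, a i * b i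

/-- `ℰ(U) = E - |m|²/(2ρ) - |B|²/2`, the internal energy `ρ e`. -/
def internalEnergy (U : State) : ℝ :=
  energy U - dot (momentum U) (momentum U) / (2 * density U)
    - dot (magnetic U) (magnetic U) / 2

/-- The admissible state set. -/
def G : Set State := {U | 0 < density U ∧ 0 < internalEnergy U}

/-- Specific internal energy `e`. -/
def specificEnergy (U : State) : ℝ := internalEnergy U / density U

/-- Thermal pressure, for the equation of state `p = eos ρ e`. -/
def pressure (eos : ℝ → ℝ → ℝ) (U : State) : ℝ := eos (density U) (specificEnergy U)

/-- The flux `F_i`; direction `i = 0` is `x`, `i = 1` is `y`. -/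
def flux (eos : ℝ → ℝ → ℝ) (i : Fin 3) (U : State) : State :=
  let v := velocity U
  let m := momentum U
  let B := magnetic U
  let ptot := pressure eos U + dot B B / 2
  let f : Fin 3 → ℝ := fun l => v i * m l - B i * B l + if l = i then ptot else 0
  let b : Fin 3 → ℝ := fun l => v i * B l - B i * v l
  ![density U * v i, f 0, f 1, f 2, b 0, b 1, b 2, v i * (energy U + ptot) - B i * dot v B]

/-- `S(U) = (0, B, v, v · B)`. -/
def sourceVec (U : State) : State :=
  let v := velocity U
  let B := magnetic U
  ![0, B 0, B 1, B 2, v 0, v 1, v 2, dot v B]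

/-! ### The wave speed bound `α_i(U, Ũ)` -/

/-- `𝒞_s = p / (ρ √(2e))`. -/
def soundLike (eos : ℝ → ℝ → ℝ) (U : State) : ℝ :=
  pressure eos U / (density U * √(2 * specificEnergy U))

/-- `𝒞_i`. -/
def fastLike (eos : ℝ → ℝ → ℝ) (i : Fin 3) (U : State) : ℝ :=
  let b := dot (magnetic U) (magnetic U) / density U
  let s := soundLike eos U ^ 2
  1 / √2 * √(b + s + √((b + s) ^ 2 - 4 * (magnetic U i ^ 2 * s / density U)))

/-- `α_i(U, Ũ)`. -/
def alpha (eos : ℝ → ℝ → ℝ) (i : Fin 3) (U V : State) : ℝ :=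
  max (max (|velocity U i| + fastLike eos i U) (|velocity V i| + fastLike eos i V))
      (|√(density U) * velocity U i + √(density V) * velocity V i| /
          (√(density U) + √(density V)) + max (fastLike eos i U) (fastLike eos i V))
    + √(dot (magnetic U - magnetic V) (magnetic U - magnetic V)) /
        (√(density U) + √(density V))

/-! ### Quadrature rules on `[-1, 1]`, with weights normalised to total mass one -/

/-- The `N`-point Gauss rule, determined by its exactness for polynomials of degree at most
`2N - 1`. -/
structure GaussRule (N : ℕ) where
  node : Fin N → ℝ
  weight : Fin N → ℝ
  strictMono : StrictMono node
  mem_Icc : ∀ μ, node μ ∈ Set.Icc (-1 : ℝ) 1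
  exact : ∀ q : Polynomial ℝ, q.natDegree < 2 * N →
    ∑ μ, weight μ * q.eval (node μ) = 1 / 2 * ∫ t in (-1 : ℝ)..1, q.eval t

/-- The Gauss–Lobatto rule with `L = n + 2` points: both endpoints `±1`, `n` interior points, and
exactness for polynomials of degree at most `2L - 3 = 2n + 1`. -/
structure GaussLobattoRule (n : ℕ) where
  node : Fin (n + 2) → ℝ
  weight : Fin (n + 2) → ℝ
  strictMono : StrictMono node
  node_first : node 0 = -1
  node_last : node (Fin.last (n + 1)) = 1
  exact : ∀ q : Polynomial ℝ, q.natDegree ≤ 2 * n + 1 →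
    ∑ ν, weight ν * q.eval (node ν) = 1 / 2 * ∫ t in (-1 : ℝ)..1, q.eval t

/-- The number of Gauss–Lobatto points for degree `k`: `⌈(k + 3) / 2⌉ = ⌊k / 2⌋ + 2`. -/
theorem lobatto_count (k : ℕ) : ⌈((k : ℚ) + 3) / 2⌉₊ = k / 2 + 2 := by
  have h1 : 2 * (k / 2) + k % 2 = k := Nat.div_add_mod k 2
  have h2 : k % 2 < 2 := Nat.mod_lt k (by norm_num)
  rw [Nat.ceil_eq_iff (by omega)]
  have h3 : (2 * ((k / 2 : ℕ) : ℚ) + ((k % 2 : ℕ) : ℚ)) = k := by exact_mod_cast h1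
  have h4 : ((k % 2 : ℕ) : ℚ) ≤ 1 := by exact_mod_cast Nat.lt_succ_iff.mp h2
  have h5 : (0 : ℚ) ≤ ((k % 2 : ℕ) : ℚ) := by positivity
  constructor
  · have : ((k / 2 + 2 - 1 : ℕ) : ℚ) = ((k / 2 : ℕ) : ℚ) + 1 := by
      rw [show k / 2 + 2 - 1 = k / 2 + 1 by omega]; push_cast; ring
    rw [this]; linarith
  · push_cast at *; linarith

/-! ### Overlapping uniform meshes and piecewise polynomial solutions -/

/-- A uniform rectangular grid: `x_s = x₀ + s Δx`, `y_s = y₀ + s Δy` for integer, half-integer and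
quarter-integer indices `s`. -/
structure Mesh where
  x₀ : ℝ
  y₀ : ℝ
  Δx : ℝ
  Δy : ℝ
  Δx_pos : 0 < Δx
  Δy_pos : 0 < Δy

def Mesh.x (M : Mesh) (s : ℝ) : ℝ := M.x₀ + s * M.Δx

def Mesh.y (M : Mesh) (s : ℝ) : ℝ := M.y₀ + s * M.Δy

/-- Eight polynomials in `(x, y)`: the restriction of a numerical solution to one cell. -/
abbrev PolyState := Fin 8 → MvPolynomial (Fin 2) ℝ

def PolyState.at (P : PolyState) (x y : ℝ) : State := fun l => MvPolynomial.eval ![x, y] (P l)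

/-- Membership in the locally divergence-free space of degree `k` for a piecewise polynomial
function given by its restriction to each cell. -/
def LocallyDF (k : ℕ) (V : ℤ × ℤ → PolyState) : Prop :=
  ∀ c, (∀ l, (V c l).totalDegree ≤ k) ∧
    MvPolynomial.pderiv 0 (V c 4) + MvPolynomial.pderiv 1 (V c 5) = 0

/-- `σ = ±1`. -/
def sgn (σ : Bool) : ℝ := if σ then 1 else -1

/-- Index shift of the right (upper) of two neighbouring cells against the left (lower) one. -/
def shift (σ : Bool) : ℤ := if σ then 1 else 0

/-- A cell of one mesh together with the solutions of both meshes on it. The cell is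
`(x_{cx-1/2}, x_{cx+1/2}) × (y_{cy-1/2}, y_{cy+1/2})`; `own` is the polynomial solution of the mesh
it belongs to. The four quarters of the cell, with centres `(x_{cx ± 1/4}, y_{cy ± 1/4})`, lie in
four different cells of the other mesh, and `other σ τ` is the polynomial solution of the other
mesh on the quarter with signs `σ, τ` (and, by continuity, its trace on the closed quarter). -/
structure CellData where
  cx : ℝ
  cy : ℝ
  own : PolyState
  other : Bool → Bool → PolyState

/-- The primal cell `I_{ij}`, centred at `(x_i, y_j)`; `UC (i, j)` lives on `I_{ij}` and
`UD (i, j)` on `I_{i+1/2,j+1/2}`. -/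
def primalCell (UC UD : ℤ × ℤ → PolyState) (c : ℤ × ℤ) : CellData where
  cx := c.1
  cy := c.2
  own := UC c
  other σ τ := UD (c.1 - 1 + shift σ, c.2 - 1 + shift τ)

/-- The dual cell `I_{i+1/2,j+1/2}`, centred at `(x_{i+1/2}, y_{j+1/2})`. -/
def dualCell (UC UD : ℤ × ℤ → PolyState) (c : ℤ × ℤ) : CellData where
  cx := c.1 + 1 / 2
  cy := c.2 + 1 / 2
  own := UD c
  other σ τ := UC (c.1 + shift σ, c.2 + shift τ)

namespace CellData

variable (K : CellData) (M : Mesh) {N n : ℕ} (g : GaussRule N) (gl : GaussLobattoRule n)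
  (eos : ℝ → ℝ → ℝ)

/-- Cell average of the solution of the cell's own mesh. -/
def ownAverage : State := fun l =>
  1 / (M.Δx * M.Δy) *
    ∫ x in M.x (K.cx - 1 / 2)..M.x (K.cx + 1 / 2),
      ∫ y in M.y (K.cy - 1 / 2)..M.y (K.cy + 1 / 2), K.own.at x y l

/-- Average over the cell of the solution of the other mesh, integrated quarter by quarter. -/
def otherAverage : State := fun l =>
  1 / (M.Δx * M.Δy) * ∑ σ : Bool, ∑ τ : Bool,
    ∫ x in M.x (K.cx + sgn σ / 4 - 1 / 4)..M.x (K.cx + sgn σ / 4 + 1 / 4),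
      ∫ y in M.y (K.cy + sgn τ / 4 - 1 / 4)..M.y (K.cy + sgn τ / 4 + 1 / 4),
        (K.other σ τ).at x y l

/-- Gauss points `x^{(μ)}_{cx + σ/4}`. -/
def gx (σ : Bool) (μ : Fin N) : ℝ := M.x (K.cx + sgn σ / 4 + g.node μ / 4)

/-- Gauss points `y^{(μ)}_{cy + τ/4}`. -/
def gy (τ : Bool) (μ : Fin N) : ℝ := M.y (K.cy + sgn τ / 4 + g.node μ / 4)

/-- Gauss–Lobatto points `x̂^{(ν)}_{cx + σ/4}`. -/
def glx (σ : Bool) (ν : Fin (n + 2)) : ℝ := M.x (K.cx + sgn σ / 4 + gl.node ν / 4)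

/-- Gauss–Lobatto points `ŷ^{(ν)}_{cy + τ/4}`. -/
def gly (τ : Bool) (ν : Fin (n + 2)) : ℝ := M.y (K.cy + sgn τ / 4 + gl.node ν / 4)

/-- The other mesh's solution is admissible at all Gauss × Gauss–Lobatto and
Gauss–Lobatto × Gauss points of the cell; at points on an interface of the other mesh this refers
to both one-sided limits. -/
def Admissible : Prop :=
  ∀ (σ τ : Bool) (μ : Fin N) (ν : Fin (n + 2)),
    (K.other σ τ).at (K.gx M g σ μ) (K.gly M gl τ ν) ∈ G ∧
    (K.other σ τ).at (K.glx M gl σ ν) (K.gy M g τ μ) ∈ G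

/-- Other mesh's solution on the left (`σ = false`) or right (`σ = true`) edge of the cell, at a
Gauss point. -/
def edgeX (σ τ : Bool) (μ : Fin N) : State :=
  (K.other σ τ).at (M.x (K.cx + sgn σ / 2)) (K.gy M g τ μ)

/-- Other mesh's solution on the lower (`τ = false`) or upper (`τ = true`) edge of the cell, at a
Gauss point. -/
def edgeY (τ σ : Bool) (μ : Fin N) : State :=
  (K.other σ τ).at (K.gx M g σ μ) (M.y (K.cy + sgn τ / 2))

/-- One-sided limits of the other mesh's solution at the vertical mid-line `x = x_{cx}`. -/
def midX (σ τ : Bool) (μ : Fin N) : State :=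
  (K.other σ τ).at (M.x K.cx) (K.gy M g τ μ)

/-- One-sided limits of the other mesh's solution at the horizontal mid-line `y = y_{cy}`. -/
def midY (τ σ : Bool) (μ : Fin N) : State :=
  (K.other σ τ).at (K.gx M g σ μ) (M.y K.cy)

/-- Jump of the normal magnetic field across the vertical mid-line. -/
def jumpX (τ : Bool) (μ : Fin N) : ℝ :=
  magnetic (K.midX M g true τ μ) 0 - magnetic (K.midX M g false τ μ) 0

/-- Jump of the normal magnetic field across the horizontal mid-line. -/
def jumpY (σ : Bool) (μ : Fin N) : ℝ :=
  magnetic (K.midY M g true σ μ) 1 - magnetic (K.midY M g false σ μ) 1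

/-- Average state on the vertical mid-line. -/
def meanX (τ : Bool) (μ : Fin N) : State :=
  (1 / 2 : ℝ) • (K.midX M g false τ μ + K.midX M g true τ μ)

/-- Average state on the horizontal mid-line. -/
def meanY (σ : Bool) (μ : Fin N) : State :=
  (1 / 2 : ℝ) • (K.midY M g false σ μ + K.midY M g true σ μ)

/-- The operator `ℒ` of the standard scheme for the cell averages. -/
def stdOp (τmax : ℝ) : State :=
  (1 / τmax) • (K.otherAverage M - K.ownAverage M)
  - (1 / M.Δx) • ∑ τ : Bool, ∑ μ, (g.weight μ / 2) •
      (flux eos 0 (K.edgeX M g true τ μ) - flux eos 0 (K.edgeX M g false τ μ))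
  - (1 / M.Δy) • ∑ σ : Bool, ∑ μ, (g.weight μ / 2) •
      (flux eos 1 (K.edgeY M g true σ μ) - flux eos 1 (K.edgeY M g false σ μ))

/-- The discretised source term `𝒮`. -/
def sourceOp : State :=
  (∑ τ : Bool, ∑ μ, (g.weight μ / 2) •
      ((-(K.jumpX M g τ μ / M.Δx)) • sourceVec (K.meanX M g τ μ)))
  + ∑ σ : Bool, ∑ μ, (g.weight μ / 2) •
      ((-(K.jumpY M g σ μ / M.Δy)) • sourceVec (K.meanY M g σ μ))

/-- The operator `ℒ^new = ℒ + 𝒮`. -/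
def newOp (τmax : ℝ) : State := K.stdOp M g eos τmax + K.sourceOp M g

/-- Forward Euler update of the cell average. -/
def update (τmax Δt : ℝ) : State := K.ownAverage M + Δt • K.newOp M g eos τmax

/-- Contributions of one cell to `â₁`, `â₂`, `β₁`, `β₂` (maxima over the finitely many Gauss
points of the cell). -/
def aHatX : ℝ := ⨆ p : Bool × Fin N,
  alpha eos 0 (K.edgeX M g true p.1 p.2) (K.edgeX M g false p.1 p.2)

def aHatY : ℝ := ⨆ p : Bool × Fin N,
  alpha eos 1 (K.edgeY M g true p.1 p.2) (K.edgeY M g false p.1 p.2)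

def betaX : ℝ := ⨆ p : Bool × Fin N,
  |K.jumpX M g p.1 p.2| / (2 * √(density (K.meanX M g p.1 p.2)))

def betaY : ℝ := ⨆ p : Bool × Fin N,
  |K.jumpY M g p.1 p.2| / (2 * √(density (K.meanY M g p.1 p.2)))

end CellData

/-- Maximum of a (nonnegative) cell quantity over the primal cells `PC` and the dual cells `DC`. -/
def maxOver (PC DC : Finset (ℤ × ℤ)) (UC UD : ℤ × ℤ → PolyState) (f : CellData → ℝ) : ℝ :=
  max (⨆ c : PC, f (primalCell UC UD c)) (⨆ c : DC, f (dualCell UC UD c))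

/-- `a₁ = max {â₁, β₁}`. -/
def speedX (M : Mesh) {N : ℕ} (g : GaussRule N) (eos : ℝ → ℝ → ℝ) (PC DC : Finset (ℤ × ℤ))
    (UC UD : ℤ × ℤ → PolyState) : ℝ :=
  max (maxOver PC DC UC UD fun K => K.aHatX M g eos) (maxOver PC DC UC UD fun K => K.betaX M g)

/-- `a₂ = max {â₂, β₂}`. -/
def speedY (M : Mesh) {N : ℕ} (g : GaussRule N) (eos : ℝ → ℝ → ℝ) (PC DC : Finset (ℤ × ℤ))
    (UC UD : ℤ × ℤ → PolyState) : ℝ :=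
  max (maxOver PC DC UC UD fun K => K.aHatY M g eos) (maxOver PC DC UC UD fun K => K.betaY M g)

end MHD

end

/-! ### Affine functionals describing `G`, and their values on fluxes and source. -/

noncomputable section
namespace MHD

/-! The set `G` is cut out by affine inequalities: `ρ > 0` together with `U · n* + |B*|²/2 > 0` for
all auxiliary vectors `v*`, `B*` (`mem_G_iff`). It therefore suffices to prove each of these
inequalities for the updated average, where linearity allows every contribution to be treated
separately.

Let `Φ(U) = U · n* + |B*|²/2`. A flux difference between opposite edges is at most `α (Φ(U) +
Φ(Ũ))`, up to the leftover `(v* · B*)(B_i - B̃_i)`, which no multiple of `Φ` absorbs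
(`flux_estimate`). The source vector, paired with `n*`, produces `-(v* · B*)` plus a term of size at
most `Φ / √ρ` (`source_estimate`). So a source multiplied by the mid-line jump subtracts exactly
that jump from the leftover, at a cost measured by `β`. Summed over the cell, what remains is `v* ·
B*` times the discrete divergence over the four quarters. It vanishes because each polynomial piece
is divergence-free and the quadrature is exact (`CellData.discrete_divergence_eq_zero`).

Fluxes and sources are now dominated by values of `Φ` on the edges and mid-lines. These are the
endpoints of the Gauss–Lobatto rules on the half intervals, so the average of the other mesh's
solution, written as a positive combination of point values, contains them with weight proportional
to `ω̂₁` (`CellData.otherAverage_ge_X`, `CellData.otherAverage_ge_Y`). The update is `(1 - θ)` times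
the own average plus `θ` times the other average plus these terms, and the CFL condition makes the
total positive. Density is handled by the same argument with zero leftover; `IsCompatible` records
what both cases share. -/

/-- The linear functional `U ↦ U · n*` with `n* = (|v*|²/2, -v*, -B*, 1)`. -/
def normalFunctional (vs Bs : Fin 3 → ℝ) : State →ₗ[ℝ] ℝ where
  toFun U := dot vs vs / 2 * density U - dot vs (momentum U) - dot Bs (magnetic U) + energy U
  map_add' U V := by
    simp [dot, density, momentum, magnetic, energy, Fin.sum_univ_three]; ring
  map_smul' r U := by
    simp [dot, density, momentum, magnetic, energy, Fin.sum_univ_three]; ring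

theorem normalFunctional_apply (vs Bs : Fin 3 → ℝ) (W : State) :
    normalFunctional vs Bs W = dot vs vs / 2 * W 0 - (vs 0 * W 1 + vs 1 * W 2 + vs 2 * W 3)
      - (Bs 0 * W 4 + Bs 1 * W 5 + Bs 2 * W 6) + W 7 := by
  simp only [normalFunctional, LinearMap.coe_mk, AddHom.coe_mk, dot, Fin.sum_univ_three]
  rfl

theorem dot_self_nonneg (a : Fin 3 → ℝ) : 0 ≤ dot a a :=
  Finset.sum_nonneg fun i _ => mul_self_nonneg (a i)

theorem momentum_eq {U : State} (hU : 0 < density U) (i : Fin 3) :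
    momentum U i = density U * velocity U i := by
  rw [velocity]; field_simp

/-- Completing the squares in velocity and magnetic field; the remainder is the internal energy,
which does not depend on `vs` and `Bs`. -/
theorem normalFunctional_eq {U : State} (hU : 0 < density U) (vs Bs : Fin 3 → ℝ) :
    normalFunctional vs Bs U + dot Bs Bs / 2 =
      density U * dot (velocity U - vs) (velocity U - vs) / 2 +
        dot (magnetic U - Bs) (magnetic U - Bs) / 2 + internalEnergy U := by
  simp only [normalFunctional, LinearMap.coe_mk, AddHom.coe_mk, internalEnergy, dot,
    Fin.sum_univ_three, momentum_eq hU, Pi.sub_apply]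
  field_simp
  ring

theorem normalFunctional_pos {U : State} (hU : U ∈ G) (vs Bs : Fin 3 → ℝ) :
    0 < normalFunctional vs Bs U + dot Bs Bs / 2 := by
  rw [normalFunctional_eq hU.1]
  have h1 := dot_self_nonneg (velocity U - vs)
  have h2 := dot_self_nonneg (magnetic U - Bs)
  have h3 := hU.2
  have h4 := mul_nonneg hU.1.le h1
  linarith

/-- The infimum over `vs`, `Bs` is attained at the state's own velocity and magnetic field, where
both squares vanish and the internal energy remains. -/
theorem mem_G_iff {U : State} :
    U ∈ G ↔ 0 < density U ∧ ∀ vs Bs, 0 < normalFunctional vs Bs U + dot Bs Bs / 2 := by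
  refine ⟨fun h => ⟨h.1, normalFunctional_pos h⟩, fun h => ⟨h.1, ?_⟩⟩
  have := h.2 (velocity U) (magnetic U)
  rw [normalFunctional_eq h.1] at this
  simpa [dot] using this

theorem half_smul_add_mem_G {U V : State} (hU : U ∈ G) (hV : V ∈ G) :
    (1 / 2 : ℝ) • (U + V) ∈ G := by
  rw [mem_G_iff] at *
  refine ⟨?_, fun vs Bs => ?_⟩
  · have h1 := hU.1
    have h2 := hV.1
    simp only [density, Pi.smul_apply, Pi.add_apply, smul_eq_mul] at *
    linarith
  · have h1 := hU.2 vs Bs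
    have h2 := hV.2 vs Bs
    rw [map_smul, map_add, smul_eq_mul]
    linarith

/-- Once `dot vs Bs * magnetic U i` is removed, the flux splits into transport by `v_i`, a magnetic
term carrying `vs i`, and a form linear in the velocity deviation that `fastLike_bound` controls.
The summand `vs i * dot Bs Bs / 2` does not depend on the state and cancels in flux differences. -/
theorem normalFunctional_flux (eos : ℝ → ℝ → ℝ) (i : Fin 3) {U : State} (hU : 0 < density U)
    (vs Bs : Fin 3 → ℝ) :
    normalFunctional vs Bs (flux eos i U) - dot vs Bs * magnetic U i =
      velocity U i * (normalFunctional vs Bs U + dot Bs Bs / 2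
        - dot (magnetic U - Bs) (magnetic U - Bs) / 2)
      + vs i * (dot (magnetic U - Bs) (magnetic U - Bs) / 2 - dot Bs Bs / 2)
      + (pressure eos U * (velocity U i - vs i)
        + (velocity U i - vs i) * dot (magnetic U) (magnetic U - Bs)
        - magnetic U i * dot (velocity U - vs) (magnetic U - Bs)) := by
  have hF : normalFunctional vs Bs (flux eos i U) =
      dot vs vs / 2 * (density U * velocity U i)
      - (vs 0 * (flux eos i U 1) + vs 1 * (flux eos i U 2) + vs 2 * (flux eos i U 3))
      - (Bs 0 * (flux eos i U 4) + Bs 1 * (flux eos i U 5) + Bs 2 * (flux eos i U 6))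
      + (velocity U i * (energy U + (pressure eos U + dot (magnetic U) (magnetic U) / 2))
        - magnetic U i * dot (velocity U) (magnetic U)) := by
    rw [normalFunctional_apply]
    rfl
  rw [hF]
  fin_cases i <;>
  · simp only [normalFunctional, LinearMap.coe_mk, AddHom.coe_mk, flux, dot, Fin.sum_univ_three,
      momentum_eq hU, Pi.sub_apply]
    simp
    ring

/-- The correction `dot vs Bs` is the multiplier found in `normalFunctional_flux`; this match is
what lets the source cancel the flux leftover. -/
theorem normalFunctional_sourceVec (U : State) (vs Bs : Fin 3 → ℝ) :
    normalFunctional vs Bs (sourceVec U) + dot vs Bs =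
      dot (velocity U - vs) (magnetic U - Bs) := by
  simp [normalFunctional, sourceVec, dot, density, energy, momentum, magnetic, Fin.sum_univ_three]
  ring

theorem abs_dot_le (a b : Fin 3 → ℝ) : |dot a b| ≤ √(dot a a) * √(dot b b) := by
  rw [← Real.sqrt_mul (dot_self_nonneg a)]
  apply Real.abs_le_sqrt
  have := Finset.sum_mul_sq_le_sq_mul_sq Finset.univ a b
  simpa only [dot, sq] using this

theorem source_estimate {U : State} (hU : U ∈ G) (vs Bs : Fin 3 → ℝ) (ξ : ℝ) :
    -(ξ * (normalFunctional vs Bs (sourceVec U) + dot vs Bs)) ≤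
      |ξ| / √(density U) * (normalFunctional vs Bs U + dot Bs Bs / 2) := by
  rw [normalFunctional_sourceVec, normalFunctional_eq hU.1]
  have hr := hU.1
  have hs : 0 < √(density U) := Real.sqrt_pos.2 hr
  have h := abs_dot_le (velocity U - vs) (magnetic U - Bs)
  have hx := Real.sq_sqrt (dot_self_nonneg (velocity U - vs))
  have hy := Real.sq_sqrt (dot_self_nonneg (magnetic U - Bs))
  have hrr := Real.sq_sqrt hr.le
  set x := √(dot (velocity U - vs) (velocity U - vs))
  set y := √(dot (magnetic U - Bs) (magnetic U - Bs))
  set s := √(density U)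
  rw [← hx, ← hy]
  -- Cauchy–Schwarz followed by `s x y ≤ (s² x² + y²) / 2`; the factor `s = √ρ` is the one in the
  -- denominator of the bound.
  have key : |dot (velocity U - vs) (magnetic U - Bs)| * s ≤
      density U * x ^ 2 / 2 + y ^ 2 / 2 + internalEnergy U := by
    have := mul_le_mul_of_nonneg_right h hs.le
    have := hU.2
    nlinarith [sq_nonneg (s * x - y)]
  have h1 := neg_le_abs (ξ * dot (velocity U - vs) (magnetic U - Bs))
  rw [abs_mul] at h1
  refine h1.trans ?_
  rw [div_mul_eq_mul_div, le_div_iff₀ hs, mul_assoc]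
  exact mul_le_mul_of_nonneg_left key (abs_nonneg ξ)

/-! ### Wave speeds and the Lax–Friedrichs type flux inequality. -/

/-- The fast speed bounds the quadratic form of the linearised flux. -/
theorem fast_quadratic_form {c s β₁ β₂ β₃ : ℝ} (hc : 0 < c)
    (hroot : c ^ 4 - (β₁ ^ 2 + β₂ ^ 2 + β₃ ^ 2 + s ^ 2) * c ^ 2 + β₁ ^ 2 * s ^ 2 = 0)
    (hlarge : β₁ ^ 2 + β₂ ^ 2 + β₃ ^ 2 + s ^ 2 ≤ 2 * c ^ 2) (x y z b d r : ℝ) :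
    s * x * r + x * (β₂ * b + β₃ * d) - β₁ * (y * b + z * d) ≤
      c / 2 * (x ^ 2 + y ^ 2 + z ^ 2 + b ^ 2 + d ^ 2 + r ^ 2) := by
  -- The root equation, factored as a vanishing determinant. The two factors have nonnegative
  -- product, and by `hlarge` nonnegative sum, so both are nonnegative.
  have hdet : (c ^ 2 - β₁ ^ 2) * (c ^ 2 - s ^ 2 - β₂ ^ 2 - β₃ ^ 2) = β₁ ^ 2 * (β₂ ^ 2 + β₃ ^ 2) := by
    linear_combination hroot
  have h0 : 0 ≤ (c ^ 2 - β₁ ^ 2) * (c ^ 2 - s ^ 2 - β₂ ^ 2 - β₃ ^ 2) := by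
    rw [hdet]; positivity
  have hA : 0 ≤ c ^ 2 - β₁ ^ 2 := by
    by_contra hneg
    push Not at hneg
    nlinarith
  have hD : 0 ≤ c ^ 2 - s ^ 2 - β₂ ^ 2 - β₃ ^ 2 := by
    by_contra hneg
    push Not at hneg
    nlinarith
  -- This is what remains after maximising over `b`, `d`, `r`: a quadratic form in `x`, `y`, `z`
  -- alone.
  have hW : s ^ 2 * x ^ 2 + (x * β₂ - β₁ * y) ^ 2 + (x * β₃ - β₁ * z) ^ 2
      ≤ c ^ 2 * (x ^ 2 + y ^ 2 + z ^ 2) := by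
    rcases hA.eq_or_lt with hA0 | hA0
    -- Degenerate case `c² = β₁²`: the determinant identity forces `β₂ = β₃ = 0`, and the form
    -- becomes diagonal.
    · have hz : β₁ ^ 2 * (β₂ ^ 2 + β₃ ^ 2) = 0 := by rw [← hdet, ← hA0]; ring
      have hβ : β₁ ^ 2 ≠ 0 := by
        have : 0 < c ^ 2 := by positivity
        linarith
      have h23 := (mul_eq_zero.1 hz).resolve_left hβ
      have h2 : β₂ = 0 := by nlinarith [sq_nonneg β₂, sq_nonneg β₃]
      have h3 : β₃ = 0 := by nlinarith [sq_nonneg β₂, sq_nonneg β₃]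
      subst h2 h3
      nlinarith [mul_nonneg hD (sq_nonneg x), mul_nonneg hA (sq_nonneg y),
        mul_nonneg hA (sq_nonneg z)]
    · have : 0 ≤ (c ^ 2 - β₁ ^ 2) * (c ^ 2 * (x ^ 2 + y ^ 2 + z ^ 2) -
          (s ^ 2 * x ^ 2 + (x * β₂ - β₁ * y) ^ 2 + (x * β₃ - β₁ * z) ^ 2)) := by
        have : (c ^ 2 - β₁ ^ 2) * (c ^ 2 * (x ^ 2 + y ^ 2 + z ^ 2) -
          (s ^ 2 * x ^ 2 + (x * β₂ - β₁ * y) ^ 2 + (x * β₃ - β₁ * z) ^ 2)) =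
          ((c ^ 2 - β₁ ^ 2) * y + β₁ * β₂ * x) ^ 2 + ((c ^ 2 - β₁ ^ 2) * z + β₁ * β₃ * x) ^ 2 := by
          linear_combination x ^ 2 * hdet
        rw [this]; positivity
      have := nonneg_of_mul_nonneg_right this hA0
      linarith
  have hfin : 2 * c * (s * x * r + x * (β₂ * b + β₃ * d) - β₁ * (y * b + z * d)) ≤
      2 * c * (c / 2 * (x ^ 2 + y ^ 2 + z ^ 2 + b ^ 2 + d ^ 2 + r ^ 2)) := by
    nlinarith [sq_nonneg (c * r - s * x), sq_nonneg (c * b - (x * β₂ - β₁ * y)),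
      sq_nonneg (c * d - (x * β₃ - β₁ * z))]
  exact le_of_mul_le_mul_left hfin (by positivity)

theorem pressure_pos {eos : ℝ → ℝ → ℝ} (heos : ∀ ρ e : ℝ, 0 < ρ → (0 < eos ρ e ↔ 0 < e))
    {U : State} (hU : U ∈ G) : 0 < pressure eos U :=
  (heos _ _ hU.1).2 (div_pos hU.2 hU.1)

theorem soundLike_pos {eos : ℝ → ℝ → ℝ} (heos : ∀ ρ e : ℝ, 0 < ρ → (0 < eos ρ e ↔ 0 < e))
    {U : State} (hU : U ∈ G) : 0 < soundLike eos U := by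
  have h1 := hU.1
  have h2 : 0 < specificEnergy U := div_pos hU.2 hU.1
  have h3 := pressure_pos heos hU
  unfold soundLike
  positivity

/-- `fastLike ^ 2` is the larger root of a quadratic. Its discriminant is at least `(b - s) ^ 2`,
because `B_i² ≤ |B|²`. -/
theorem fastLike_spec {eos : ℝ → ℝ → ℝ} (heos : ∀ ρ e : ℝ, 0 < ρ → (0 < eos ρ e ↔ 0 < e))
    (i : Fin 3) {U : State} (hU : U ∈ G) :
    0 < fastLike eos i U ∧
    fastLike eos i U ^ 4 - (dot (magnetic U) (magnetic U) / density U + soundLike eos U ^ 2)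
      * fastLike eos i U ^ 2 + magnetic U i ^ 2 / density U * soundLike eos U ^ 2 = 0 ∧
    dot (magnetic U) (magnetic U) / density U + soundLike eos U ^ 2 ≤
      2 * fastLike eos i U ^ 2 := by
  have hr := hU.1
  have hs := soundLike_pos heos hU
  have hi : magnetic U i ^ 2 ≤ dot (magnetic U) (magnetic U) := by
    rw [sq]
    exact Finset.single_le_sum (f := fun j => magnetic U j * magnetic U j)
      (fun j _ => mul_self_nonneg _) (Finset.mem_univ i)
  set b := dot (magnetic U) (magnetic U) / density U with hb
  set s := soundLike eos U ^ 2 with hsd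
  have hs0 : 0 < s := by positivity
  have hbi : magnetic U i ^ 2 / density U ≤ b := by rw [hb]; gcongr
  have hbi0 : 0 ≤ magnetic U i ^ 2 / density U := by positivity
  set t := magnetic U i ^ 2 / density U with ht
  have hdisc : 0 ≤ (b + s) ^ 2 - 4 * (magnetic U i ^ 2 * s / density U) := by
    have : magnetic U i ^ 2 * s / density U = t * s := by rw [ht]; ring
    rw [this]
    nlinarith [sq_nonneg (b - s)]
  set D := √((b + s) ^ 2 - 4 * (magnetic U i ^ 2 * s / density U)) with hD
  have hD0 : 0 ≤ D := Real.sqrt_nonneg _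
  have hD2 : D ^ 2 = (b + s) ^ 2 - 4 * (t * s) := by
    rw [hD, Real.sq_sqrt hdisc, ht]; ring
  have hb0 : 0 ≤ b := hbi0.trans hbi
  have hC : fastLike eos i U = 1 / √2 * √(b + s + D) := rfl
  have hC2 : fastLike eos i U ^ 2 = (b + s + D) / 2 := by
    rw [hC, mul_pow, Real.sq_sqrt (by positivity), div_pow, Real.sq_sqrt (by norm_num)]; ring
  have hC4 : fastLike eos i U ^ 4 = ((b + s + D) / 2) ^ 2 := by rw [← hC2]; ring
  refine ⟨by rw [hC]; positivity, ?_, by rw [hC2]; linarith⟩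
  rw [hC4, hC2]
  linear_combination hD2 / 4

/-- Rescaling by `x = √ρ w` and `r = √ρ √(2e)` makes the energy on the right half a sum of squares,
since `r² = 2ρe`, and turns the pressure term into `𝒞_s x r`; this is the reason for the form of
`𝒞_s`. The products with `b i` cancel, leaving `fast_quadratic_form`. -/
theorem fastLike_bound {eos : ℝ → ℝ → ℝ} (heos : ∀ ρ e : ℝ, 0 < ρ → (0 < eos ρ e ↔ 0 < e))
    (i : Fin 3) {U : State} (hU : U ∈ G) (w b : Fin 3 → ℝ) :
    |pressure eos U * w i + w i * dot (magnetic U) b - magnetic U i * dot w b| ≤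
      fastLike eos i U * (density U * dot w w / 2 + dot b b / 2 + internalEnergy U) := by
  have main : ∀ w : Fin 3 → ℝ,
      pressure eos U * w i + w i * dot (magnetic U) b - magnetic U i * dot w b ≤
      fastLike eos i U * (density U * dot w w / 2 + dot b b / 2 + internalEnergy U) := by
    intro w
    obtain ⟨hc, hroot, hlarge⟩ := fastLike_spec heos i hU
    have hr := hU.1
    have hε := hU.2
    have hq : 0 < √(density U) := Real.sqrt_pos.2 hr
    have hq2 : √(density U) ^ 2 = density U := Real.sq_sqrt hr.le
    have he : 0 < 2 * specificEnergy U := by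
      have : 0 < specificEnergy U := div_pos hU.2 hU.1
      linarith
    have hk : 0 < √(2 * specificEnergy U) := Real.sqrt_pos.2 he
    have hk2 : √(2 * specificEnergy U) ^ 2 = 2 * specificEnergy U := Real.sq_sqrt he.le
    have hp : pressure eos U = soundLike eos U * density U * √(2 * specificEnergy U) := by
      unfold soundLike; field_simp
    have hi : internalEnergy U = density U * specificEnergy U := by
      unfold specificEnergy; field_simp
    set c := fastLike eos i U
    set s := soundLike eos U
    set q := √(density U)
    set k := √(2 * specificEnergy U)
    have hi2 : internalEnergy U = q ^ 2 * k ^ 2 / 2 := by rw [hi, hq2, hk2]; ring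
    rw [hp, hi2]
    rw [← hq2] at hroot hlarge ⊢
    generalize magnetic U = B at *
    fin_cases i
    · simp only [dot, Fin.sum_univ_three, Fin.zero_eta] at hroot hlarge ⊢
      have := fast_quadratic_form (β₁ := B 0 / q) (β₂ := B 1 / q) (β₃ := B 2 / q) (s := s) hc
        (by rw [← hroot]; ring) (by refine le_trans (le_of_eq ?_) hlarge; ring)
        (q * w 0) (q * w 1) (q * w 2) (b 1) (b 2) (q * k)
      have h2 : s * (q * w 0) * (q * k) + q * w 0 * (B 1 / q * b 1 + B 2 / q * b 2)
          - B 0 / q * (q * w 1 * b 1 + q * w 2 * b 2) =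
          s * q ^ 2 * k * w 0 + w 0 * (B 0 * b 0 + B 1 * b 1 + B 2 * b 2)
          - B 0 * (w 0 * b 0 + w 1 * b 1 + w 2 * b 2) := by field_simp; ring
      have h3 := mul_nonneg hc.le (sq_nonneg (b 0))
      rw [h2] at this
      linarith
    · simp only [dot, Fin.sum_univ_three, Fin.mk_one] at hroot hlarge ⊢
      have := fast_quadratic_form (β₁ := B 1 / q) (β₂ := B 0 / q) (β₃ := B 2 / q) (s := s) hc
        (by rw [← hroot]; ring) (by refine le_trans (le_of_eq ?_) hlarge; ring)
        (q * w 1) (q * w 0) (q * w 2) (b 0) (b 2) (q * k)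
      have h2 : s * (q * w 1) * (q * k) + q * w 1 * (B 0 / q * b 0 + B 2 / q * b 2)
          - B 1 / q * (q * w 0 * b 0 + q * w 2 * b 2) =
          s * q ^ 2 * k * w 1 + w 1 * (B 0 * b 0 + B 1 * b 1 + B 2 * b 2)
          - B 1 * (w 0 * b 0 + w 1 * b 1 + w 2 * b 2) := by field_simp; ring
      have h3 := mul_nonneg hc.le (sq_nonneg (b 1))
      rw [h2] at this
      linarith
    · simp only [dot, Fin.sum_univ_three, Fin.reduceFinMk] at hroot hlarge ⊢
      have := fast_quadratic_form (β₁ := B 2 / q) (β₂ := B 0 / q) (β₃ := B 1 / q) (s := s) hc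
        (by rw [← hroot]; ring) (by refine le_trans (le_of_eq ?_) hlarge; ring)
        (q * w 2) (q * w 0) (q * w 1) (b 0) (b 1) (q * k)
      have h2 : s * (q * w 2) * (q * k) + q * w 2 * (B 0 / q * b 0 + B 1 / q * b 1)
          - B 2 / q * (q * w 0 * b 0 + q * w 1 * b 1) =
          s * q ^ 2 * k * w 2 + w 2 * (B 0 * b 0 + B 1 * b 1 + B 2 * b 2)
          - B 2 * (w 0 * b 0 + w 1 * b 1 + w 2 * b 2) := by field_simp; ring
      have h3 := mul_nonneg hc.le (sq_nonneg (b 2))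
      rw [h2] at this
      linarith
  -- The left side is odd in `w` and the right side even, so the lower bound is `main` at `-w`.
  refine abs_le.2 ⟨?_, main w⟩
  have h := main (-w)
  have e1 : dot (-w) b = -dot w b := by simp [dot]
  have e2 : dot (-w) (-w) = dot w w := by simp [dot]
  rw [e1, e2, Pi.neg_apply] at h
  linarith

theorem alpha_ge {eos : ℝ → ℝ → ℝ} {i : Fin 3} {U V : State} :
    let J := √(dot (magnetic U - magnetic V) (magnetic U - magnetic V)) /
        (√(density U) + √(density V))
    let A := alpha eos i U V - J
    |velocity U i| + fastLike eos i U ≤ A ∧ |velocity V i| + fastLike eos i V ≤ A ∧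
    |√(density U) * velocity U i + √(density V) * velocity V i| /
          (√(density U) + √(density V)) + fastLike eos i U ≤ A ∧
    |√(density U) * velocity U i + √(density V) * velocity V i| /
          (√(density U) + √(density V)) + fastLike eos i V ≤ A := by
  intro J A
  have hA : A = max (max (|velocity U i| + fastLike eos i U) (|velocity V i| + fastLike eos i V))
      (|√(density U) * velocity U i + √(density V) * velocity V i| /
          (√(density U) + √(density V)) + max (fastLike eos i U) (fastLike eos i V)) := by
    simp only [A, J, alpha]; ring
  rw [hA]
  refine ⟨?_, ?_, ?_, ?_⟩
  · exact (le_max_left _ _).trans (le_max_left _ _)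
  · exact (le_max_right _ _).trans (le_max_left _ _)
  · exact le_trans (by gcongr; exact le_max_left _ _) (le_max_right _ _)
  · exact le_trans (by gcongr; exact le_max_right _ _) (le_max_right _ _)

/-- The generalised Lax–Friedrichs splitting property. -/
theorem flux_estimate {eos : ℝ → ℝ → ℝ} (heos : ∀ ρ e : ℝ, 0 < ρ → (0 < eos ρ e ↔ 0 < e))
    (i : Fin 3) {U V : State} (hU : U ∈ G) (hV : V ∈ G) (vs Bs : Fin 3 → ℝ) :
    normalFunctional vs Bs (flux eos i U) - normalFunctional vs Bs (flux eos i V)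
        - dot vs Bs * (magnetic U i - magnetic V i) ≤
      alpha eos i U V * ((normalFunctional vs Bs U + dot Bs Bs / 2) +
        (normalFunctional vs Bs V + dot Bs Bs / 2)) := by
  have hfU := normalFunctional_flux eos i hU.1 vs Bs
  have hfV := normalFunctional_flux eos i hV.1 vs Bs
  have hqU := (abs_le.1 (fastLike_bound heos i hU (velocity U - vs) (magnetic U - Bs))).2
  have hqV := (abs_le.1 (fastLike_bound heos i hV (velocity V - vs) (magnetic V - Bs))).1
  obtain ⟨a1, a2, a3, a4⟩ := alpha_ge (eos := eos) (i := i) (U := U) (V := V)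
  have eU := normalFunctional_eq hU.1 vs Bs
  have eV := normalFunctional_eq hV.1 vs Bs
  simp only [Pi.sub_apply] at hqU hqV
  have hxU := dot_self_nonneg (velocity U - vs)
  have hxV := dot_self_nonneg (velocity V - vs)
  have hbU := dot_self_nonneg (magnetic U - Bs)
  have hbV := dot_self_nonneg (magnetic V - Bs)
  have hp : 0 < √(density U) := Real.sqrt_pos.2 hU.1
  have hq : 0 < √(density V) := Real.sqrt_pos.2 hV.1
  have hp2 : √(density U) ^ 2 = density U := Real.sq_sqrt hU.1.le
  have hq2 : √(density V) ^ 2 = density V := Real.sq_sqrt hV.1.le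
  have hcU := (fastLike_spec heos i hU).1
  have hcV := (fastLike_spec heos i hV).1
  have hwU : (velocity U i - vs i) ^ 2 ≤ dot (velocity U - vs) (velocity U - vs) := by
    rw [sq]
    exact Finset.single_le_sum (f := fun j => (velocity U - vs) j * (velocity U - vs) j)
      (fun j _ => mul_self_nonneg _) (Finset.mem_univ i)
  have hwV : (velocity V i - vs i) ^ 2 ≤ dot (velocity V - vs) (velocity V - vs) := by
    rw [sq]
    exact Finset.single_le_sum (f := fun j => (velocity V - vs) j * (velocity V - vs) j)
      (fun j _ => mul_self_nonneg _) (Finset.mem_univ i)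
  have hdiff : dot (magnetic U - Bs) (magnetic U - Bs) - dot (magnetic V - Bs) (magnetic V - Bs)
      = dot (magnetic U - magnetic V) ((magnetic U - Bs) + (magnetic V - Bs)) := by
    simp only [dot, Fin.sum_univ_three, Pi.sub_apply, Pi.add_apply]; ring
  have hcs := abs_dot_le (magnetic U - magnetic V) ((magnetic U - Bs) + (magnetic V - Bs))
  rw [← hdiff] at hcs
  have hpar : dot ((magnetic U - Bs) + (magnetic V - Bs)) ((magnetic U - Bs) + (magnetic V - Bs))
      ≤ 2 * (dot (magnetic U - Bs) (magnetic U - Bs) + dot (magnetic V - Bs) (magnetic V - Bs)) := by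
    simp only [dot, Fin.sum_univ_three, Pi.sub_apply, Pi.add_apply]
    linarith only [sq_nonneg (magnetic U 0 - magnetic V 0), sq_nonneg (magnetic U 1 - magnetic V 1),
      sq_nonneg (magnetic U 2 - magnetic V 2)]
  have hz2 := Real.sq_sqrt (dot_self_nonneg ((magnetic U - Bs) + (magnetic V - Bs)))
  have hd0 := Real.sqrt_nonneg (dot (magnetic U - magnetic V) (magnetic U - magnetic V))
  have hεU := hU.2
  have hεV := hV.2
  set d := √(dot (magnetic U - magnetic V) (magnetic U - magnetic V))
  set z := √(dot ((magnetic U - Bs) + (magnetic V - Bs)) ((magnetic U - Bs) + (magnetic V - Bs)))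
  set p := √(density U)
  set q := √(density V)
  set bU := dot (magnetic U - Bs) (magnetic U - Bs)
  set bV := dot (magnetic V - Bs) (magnetic V - Bs)
  set xU := dot (velocity U - vs) (velocity U - vs)
  set xV := dot (velocity V - vs) (velocity V - vs)
  set ΦU := normalFunctional vs Bs U + dot Bs Bs / 2
  set ΦV := normalFunctional vs Bs V + dot Bs Bs / 2
  set α := alpha eos i U V
  set vU := velocity U i
  set vV := velocity V i
  set cU := fastLike eos i U
  set cV := fastLike eos i V
  have hpq : 0 < p + q := by positivity
  -- The free parameter `vs i` multiplies `(bU - bV) / 2` and is unbounded. It is written as the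
  -- Roe-type mean `m`, which `α` controls, minus `u / (p + q)`, which is built from the deviations
  -- `v - v*` and so is controlled by the kinetic part of `Φ`.
  set m := (p * vU + q * vV) / (p + q) with hm
  have hmabs : |p * vU + q * vV| / (p + q) = |m| := by rw [hm, abs_div, abs_of_pos hpq]
  rw [hmabs] at a3 a4
  set u := (p * (vU - vs i) + q * (vV - vs i)) with hu
  have hvs : vs i = m - u / (p + q) := by rw [hm, hu]; field_simp; ring
  -- the part of `v*` not controlled by the Roe-type mean velocity
  have hu2 : u ^ 2 ≤ 2 * (density U * xU + density V * xV) := by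
    have h1 := mul_le_mul_of_nonneg_left hwU hU.1.le
    have h2 := mul_le_mul_of_nonneg_left hwV hV.1.le
    rw [← hp2] at h1 ⊢
    rw [← hq2] at h2 ⊢
    rw [hu]
    have h3 := sq_nonneg (p * (vU - vs i) - q * (vV - vs i))
    linarith only [h1, h2, h3]
  -- Cauchy–Schwarz gives `|bU - bV| ≤ d z`, and `|u| z` is absorbed by the energies; the price `d /
  -- (p + q)` is the last summand of `α`.
  have hJ : -(u / (p + q)) * ((bU - bV) / 2) ≤ d / (p + q) *
      (density U * xU / 2 + density V * xV / 2 + bU / 2 + bV / 2) := by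
    have h1 : -u * (bU - bV) ≤ |u| * (d * z) := by
      calc -u * (bU - bV) ≤ |-u * (bU - bV)| := le_abs_self _
        _ = |u| * |bU - bV| := by rw [abs_mul, abs_neg]
        _ ≤ _ := by gcongr
    have h2 : |u| * z ≤ density U * xU + density V * xV + bU + bV := by
      have h3 := sq_nonneg (|u| - z)
      have h4 := sq_abs u
      linarith only [h3, h4, hz2, hpar, hu2]
    have h3 : -u * (bU - bV) ≤ d * (density U * xU + density V * xV + bU + bV) := by
      calc _ ≤ |u| * (d * z) := h1
        _ = d * (|u| * z) := by ring
        _ ≤ _ := by gcongr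
    rw [← sub_nonneg]
    have : d / (p + q) * (density U * xU / 2 + density V * xV / 2 + bU / 2 + bV / 2)
        - -(u / (p + q)) * ((bU - bV) / 2) =
        (d * (density U * xU + density V * xV + bU + bV) - -u * (bU - bV)) / (2 * (p + q)) := by
      field_simp
    rw [this]
    apply div_nonneg <;> linarith
  have hJ' : d / (p + q) * (density U * xU / 2 + density V * xV / 2 + bU / 2 + bV / 2) ≤
      d / (p + q) * (ΦU + ΦV) := by
    apply mul_le_mul_of_nonneg_left _ (by positivity)
    linarith
  have hm1 : m * ((bU - bV) / 2) ≤ |m| * (bU / 2) + |m| * (bV / 2) := by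
    have h1 := mul_le_mul_of_nonneg_right (le_abs_self m) hbU
    have h2 := mul_le_mul_of_nonneg_right (neg_abs_le m) hbV
    linarith only [h1, h2]
  have kU : 0 ≤ density U * xU := mul_nonneg hU.1.le hxU
  have kV : 0 ≤ density V * xV := mul_nonneg hV.1.le hxV
  have hvU : vU * (ΦU - bU / 2) ≤ |vU| * (ΦU - bU / 2) :=
    mul_le_mul_of_nonneg_right (le_abs_self _) (by linarith)
  have hvV : -vV * (ΦV - bV / 2) ≤ |vV| * (ΦV - bV / 2) :=
    mul_le_mul_of_nonneg_right (neg_le_abs _) (by linarith)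
  -- Each `Φ` is split into `Φ - b/2`, transported with the local velocity, and `b/2`, transported
  -- with the mean velocity `m`. Each piece uses its own entry of the maximum in `α`.
  have s1 := mul_le_mul_of_nonneg_right a1 (show 0 ≤ ΦU - bU / 2 by linarith)
  have s2 := mul_le_mul_of_nonneg_right a2 (show 0 ≤ ΦV - bV / 2 by linarith)
  have s3 := mul_le_mul_of_nonneg_right a3 (show 0 ≤ bU / 2 by linarith)
  have s4 := mul_le_mul_of_nonneg_right a4 (show 0 ≤ bV / 2 by linarith)
  have hvsb : vs i * ((bU - bV) / 2) = m * ((bU - bV) / 2) + -(u / (p + q)) * ((bU - bV) / 2) := by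
    rw [hvs]; ring
  rw [← eU] at hqU
  rw [← eV] at hqV
  linarith

theorem abs_velocity_left_lt_alpha {eos : ℝ → ℝ → ℝ} (heos : ∀ ρ e : ℝ, 0 < ρ → (0 < eos ρ e ↔ 0 < e))
    (i : Fin 3) {U V : State} (hU : U ∈ G) :
    |velocity U i| < alpha eos i U V := by
  obtain ⟨a1, -⟩ := alpha_ge (eos := eos) (i := i) (U := U) (V := V)
  have := (fastLike_spec heos i hU).1
  have hJ : 0 ≤ √(dot (magnetic U - magnetic V) (magnetic U - magnetic V)) /
        (√(density U) + √(density V)) := by positivity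
  linarith

theorem abs_velocity_right_lt_alpha {eos : ℝ → ℝ → ℝ} (heos : ∀ ρ e : ℝ, 0 < ρ → (0 < eos ρ e ↔ 0 < e))
    (i : Fin 3) {U V : State} (hV : V ∈ G) :
    |velocity V i| < alpha eos i U V := by
  obtain ⟨-, a1, -⟩ := alpha_ge (eos := eos) (i := i) (U := U) (V := V)
  have := (fastLike_spec heos i hV).1
  have hJ : 0 ≤ √(dot (magnetic U - magnetic V) (magnetic U - magnetic V)) /
        (√(density U) + √(density V)) := by positivity
  linarith

theorem density_flux_estimate {eos : ℝ → ℝ → ℝ}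
    (heos : ∀ ρ e : ℝ, 0 < ρ → (0 < eos ρ e ↔ 0 < e))
    (i : Fin 3) {U V : State} (hU : U ∈ G) (hV : V ∈ G) :
    density (flux eos i U) - density (flux eos i V) ≤
      alpha eos i U V * (density U + density V) := by
  have h1 := (le_abs_self _).trans (abs_velocity_left_lt_alpha heos i (V := V) hU).le
  have h2 := (neg_le_abs _).trans (abs_velocity_right_lt_alpha heos i (U := U) hV).le
  have h3 := mul_le_mul_of_nonneg_left h1 hU.1.le
  have h4 := mul_le_mul_of_nonneg_left h2 hV.1.le
  have e1 : ∀ W, density (flux eos i W) = density W * velocity W i := fun W => rfl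
  rw [e1, e1]
  linarith

end MHD
end

noncomputable section
namespace MHD
open Polynomial

/-! ### Slices of bivariate polynomials -/

/-- The univariate polynomial `x ↦ P(x, y)`. -/
def sliceX (P : MvPolynomial (Fin 2) ℝ) (y : ℝ) : ℝ[X] := MvPolynomial.aeval ![X, C y] P

/-- The univariate polynomial `y ↦ P(x, y)`. -/
def sliceY (P : MvPolynomial (Fin 2) ℝ) (x : ℝ) : ℝ[X] := MvPolynomial.aeval ![C x, X] P

theorem eval_sliceX (P : MvPolynomial (Fin 2) ℝ) (x y : ℝ) :
    (sliceX P y).eval x = MvPolynomial.eval ![x, y] P := by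
  induction P using MvPolynomial.induction_on with
  | C a => simp [sliceX]
  | add p q hp hq => simp only [sliceX, map_add, eval_add] at *; rw [hp, hq]
  | mul_X p i hp =>
    simp only [sliceX, map_mul, eval_mul, MvPolynomial.aeval_X, MvPolynomial.eval_X] at *
    rw [hp]; fin_cases i <;> simp

theorem eval_sliceY (P : MvPolynomial (Fin 2) ℝ) (x y : ℝ) :
    (sliceY P x).eval y = MvPolynomial.eval ![x, y] P := by
  induction P using MvPolynomial.induction_on with
  | C a => simp [sliceY]
  | add p q hp hq => simp only [sliceY, map_add, eval_add] at *; rw [hp, hq]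
  | mul_X p i hp =>
    simp only [sliceY, map_mul, eval_mul, MvPolynomial.aeval_X, MvPolynomial.eval_X] at *
    rw [hp]; fin_cases i <;> simp

theorem natDegree_sliceX_le {P : MvPolynomial (Fin 2) ℝ} {k : ℕ} (hP : P.totalDegree ≤ k) (y : ℝ) :
    (sliceX P y).natDegree ≤ k := by
  have := MvPolynomial.aeval_natDegree_le (n := 1) P hP ![X, C y]
    (fun i => by fin_cases i <;> simp)
  rw [mul_one] at this
  exact this

theorem natDegree_sliceY_le {P : MvPolynomial (Fin 2) ℝ} {k : ℕ} (hP : P.totalDegree ≤ k) (x : ℝ) :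
    (sliceY P x).natDegree ≤ k := by
  have := MvPolynomial.aeval_natDegree_le (n := 1) P hP ![C x, X]
    (fun i => by fin_cases i <;> simp)
  rw [mul_one] at this
  exact this

theorem derivative_sliceX (P : MvPolynomial (Fin 2) ℝ) (y : ℝ) :
    derivative (sliceX P y) = sliceX (MvPolynomial.pderiv 0 P) y := by
  induction P using MvPolynomial.induction_on with
  | C a => simp [sliceX]
  | add p q hp hq => simp only [sliceX, map_add] at *; rw [hp, hq]
  | mul_X p i hp =>
    simp only [sliceX, map_mul, derivative_mul, MvPolynomial.aeval_X, Derivation.leibniz, map_add,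
      smul_eq_mul] at *
    rw [hp]
    fin_cases i <;> simp [MvPolynomial.pderiv_X] <;> ring

theorem derivative_sliceY (P : MvPolynomial (Fin 2) ℝ) (x : ℝ) :
    derivative (sliceY P x) = sliceY (MvPolynomial.pderiv 1 P) x := by
  induction P using MvPolynomial.induction_on with
  | C a => simp [sliceY]
  | add p q hp hq => simp only [sliceY, map_add] at *; rw [hp, hq]
  | mul_X p i hp =>
    simp only [sliceY, map_mul, derivative_mul, MvPolynomial.aeval_X, Derivation.leibniz, map_add,
      smul_eq_mul] at *
    rw [hp]
    fin_cases i <;> simp [MvPolynomial.pderiv_X] <;> ring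

/-! ### Quadrature on intervals -/

/-- A quadrature rule on `[-1, 1]` of total mass one that is exact up to degree `d`. -/
def QuadExact {ι : Type*} [Fintype ι] (node weight : ι → ℝ) (d : ℕ) : Prop :=
  ∀ q : ℝ[X], q.natDegree ≤ d →
    ∑ j, weight j * q.eval (node j) = 1 / 2 * ∫ t in (-1 : ℝ)..1, q.eval t

theorem GaussRule.quadExact {k : ℕ} (g : GaussRule (k + 1)) : QuadExact g.node g.weight k :=
  fun q hq => g.exact q (by omega)

/-- `2 * (k / 2) + 1 ≥ k` for either parity of `k`. Degree `k` suffices because exactness is needed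
only for terms linear in the solution, never for the fluxes. -/
theorem GaussLobattoRule.quadExact {k : ℕ} (gl : GaussLobattoRule (k / 2)) :
    QuadExact gl.node gl.weight k :=
  fun q hq => gl.exact q (by omega)

section
variable {ι : Type*} [Fintype ι] {node weight : ι → ℝ} {d : ℕ}

theorem QuadExact.sum_weight (h : QuadExact node weight d) : ∑ j, weight j = 1 := by
  have := h 1 (by simp)
  simp at this
  rw [this]; norm_num

theorem QuadExact.integral_eq (h : QuadExact node weight d) {q : ℝ[X]} (hq : q.natDegree ≤ d)
    (m : ℝ) {r : ℝ} (hr : 0 < r) :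
    ∫ t in (m - r)..(m + r), q.eval t = 2 * r * ∑ j, weight j * q.eval (m + r * node j) := by
  have hdeg : (q.comp (C m + C r * X)).natDegree ≤ d := by
    refine natDegree_comp_le.trans ?_
    have h1 : (C m + C r * X).natDegree ≤ 1 := by
      rw [add_comm]; exact natDegree_linear_le
    calc q.natDegree * _ ≤ q.natDegree * 1 := by gcongr
      _ ≤ d := by simpa using hq
  have h2 := h _ hdeg
  simp only [eval_comp, eval_add, eval_C, eval_mul, eval_X] at h2
  rw [h2, intervalIntegral.integral_comp_add_mul (fun t => q.eval t) hr.ne' m]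
  simp only [smul_eq_mul, mul_neg, mul_one]
  rw [← sub_eq_add_neg]
  field_simp

theorem QuadExact.integral_sliceX (h : QuadExact node weight d) {P : MvPolynomial (Fin 2) ℝ}
    (hP : P.totalDegree ≤ d) (m y : ℝ) {r : ℝ} (hr : 0 < r) :
    ∫ x in (m - r)..(m + r), MvPolynomial.eval ![x, y] P =
      2 * r * ∑ j, weight j * MvPolynomial.eval ![m + r * node j, y] P := by
  simpa only [eval_sliceX] using h.integral_eq (natDegree_sliceX_le hP y) m hr

theorem QuadExact.integral_sliceY (h : QuadExact node weight d) {P : MvPolynomial (Fin 2) ℝ}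
    (hP : P.totalDegree ≤ d) (m x : ℝ) {r : ℝ} (hr : 0 < r) :
    ∫ y in (m - r)..(m + r), MvPolynomial.eval ![x, y] P =
      2 * r * ∑ j, weight j * MvPolynomial.eval ![x, m + r * node j] P := by
  simpa only [eval_sliceY] using h.integral_eq (natDegree_sliceY_le hP x) m hr

theorem QuadExact.integral_prod {κ : Type*} [Fintype κ] {node' weight' : κ → ℝ}
    (h : QuadExact node weight d) (h' : QuadExact node' weight' d) {P : MvPolynomial (Fin 2) ℝ}
    (hP : P.totalDegree ≤ d) (m n : ℝ) {r s : ℝ} (hr : 0 < r) (hs : 0 < s) :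
    ∫ x in (m - r)..(m + r), ∫ y in (n - s)..(n + s), MvPolynomial.eval ![x, y] P =
      2 * r * (2 * s) * ∑ i, ∑ j, weight i * weight' j *
        MvPolynomial.eval ![m + r * node i, n + s * node' j] P := by
  simp only [h'.integral_sliceY hP _ _ hs]
  rw [intervalIntegral.integral_const_mul, intervalIntegral.integral_finsetSum]
  · simp only [intervalIntegral.integral_const_mul, h.integral_sliceX hP _ _ hr, Finset.mul_sum]
    rw [Finset.sum_comm]
    exact Finset.sum_congr rfl fun i _ => Finset.sum_congr rfl fun j _ => by ring
  · intro j _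
    apply Continuous.intervalIntegrable
    simp only [← eval_sliceX]
    exact continuous_const.mul (Polynomial.continuous _)

/-- The boundary difference is the integral of the derivative, which the rule integrates exactly. -/
theorem QuadExact.sub_sliceX (h : QuadExact node weight d) {P : MvPolynomial (Fin 2) ℝ}
    (hP : P.totalDegree ≤ d) (m y : ℝ) {r : ℝ} (hr : 0 < r) :
    MvPolynomial.eval ![m + r, y] P - MvPolynomial.eval ![m - r, y] P =
      2 * r * ∑ j, weight j * MvPolynomial.eval ![m + r * node j, y] (MvPolynomial.pderiv 0 P) := by
  have hdeg : (derivative (sliceX P y)).natDegree ≤ d :=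
    (natDegree_derivative_le _).trans ((Nat.sub_le _ _).trans (natDegree_sliceX_le hP y))
  have h1 := h.integral_eq hdeg m hr
  rw [intervalIntegral.integral_eq_sub_of_hasDerivAt (fun x _ => (sliceX P y).hasDerivAt x)
    ((Polynomial.continuous _).intervalIntegrable _ _)] at h1
  simpa only [derivative_sliceX, eval_sliceX] using h1

theorem QuadExact.sub_sliceY (h : QuadExact node weight d) {P : MvPolynomial (Fin 2) ℝ}
    (hP : P.totalDegree ≤ d) (m x : ℝ) {r : ℝ} (hr : 0 < r) :
    MvPolynomial.eval ![x, m + r] P - MvPolynomial.eval ![x, m - r] P =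
      2 * r * ∑ j, weight j * MvPolynomial.eval ![x, m + r * node j] (MvPolynomial.pderiv 1 P) := by
  have hdeg : (derivative (sliceY P x)).natDegree ≤ d :=
    (natDegree_derivative_le _).trans ((Nat.sub_le _ _).trans (natDegree_sliceY_le hP x))
  have h1 := h.integral_eq hdeg m hr
  rw [intervalIntegral.integral_eq_sub_of_hasDerivAt (fun y _ => (sliceY P x).hasDerivAt y)
    ((Polynomial.continuous _).intervalIntegrable _ _)] at h1
  simpa only [derivative_sliceY, eval_sliceY] using h1

/-- The discrete divergence of a divergence-free polynomial field over a rectangle vanishes. -/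
theorem QuadExact.discrete_divergence (h : QuadExact node weight d)
    {P Q : MvPolynomial (Fin 2) ℝ} (hP : P.totalDegree ≤ d) (hQ : Q.totalDegree ≤ d)
    (hdiv : MvPolynomial.pderiv 0 P + MvPolynomial.pderiv 1 Q = 0)
    (m n : ℝ) {r s : ℝ} (hr : 0 < r) (hs : 0 < s) :
    1 / r * ∑ j, weight j * (MvPolynomial.eval ![m + r, n + s * node j] P
        - MvPolynomial.eval ![m - r, n + s * node j] P)
      + 1 / s * ∑ j, weight j * (MvPolynomial.eval ![m + r * node j, n + s] Q
        - MvPolynomial.eval ![m + r * node j, n - s] Q) = 0 := by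
  simp only [h.sub_sliceX hP _ _ hr, h.sub_sliceY hQ _ _ hs]
  have hQ' : MvPolynomial.pderiv 1 Q = -MvPolynomial.pderiv 0 P := by
    rw [eq_neg_iff_add_eq_zero, add_comm]; exact hdiv
  simp only [hQ', map_neg, Finset.mul_sum]
  -- With the same rule on both axes, the two boundary terms become sums over the same tensor grid,
  -- and the divergence cancels point by point.
  rw [Finset.sum_comm, ← Finset.sum_add_distrib]
  refine Finset.sum_eq_zero fun i _ => ?_
  rw [← Finset.sum_add_distrib]
  refine Finset.sum_eq_zero fun j _ => ?_
  field_simp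
  ring

end

/-! ### Positivity and symmetry of the weights -/

theorem integral_eval_pos {q : ℝ[X]} (hq : q ≠ 0) (hnn : ∀ t ∈ Set.Ioc (-1 : ℝ) 1, 0 ≤ q.eval t) :
    0 < ∫ t in (-1 : ℝ)..1, q.eval t := by
  apply intervalIntegral.integral_pos (by norm_num) q.continuous.continuousOn hnn
  by_contra hcon
  push Not at hcon
  apply hq
  apply Polynomial.eq_zero_of_infinite_isRoot
  refine (Set.Ioc_infinite (show (-1 : ℝ) < 1 by norm_num)).mono fun t ht => ?_
  exact le_antisymm (hcon t (Set.Ioc_subset_Icc_self ht)) (hnn t ht)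

/-- Exactness is tested on the squared product of `X - node` over the other nodes, of degree `2N -
2`: only one node contributes, and the integral is positive. -/
theorem GaussRule.weight_pos {N : ℕ} (g : GaussRule N) (μ : Fin N) : 0 < g.weight μ := by
  set q : ℝ[X] := (∏ j ∈ Finset.univ.erase μ, (X - C (g.node j))) ^ 2 with hq
  have hq0 : q ≠ 0 := pow_ne_zero _ (Finset.prod_ne_zero_iff.2 fun j _ => X_sub_C_ne_zero _)
  have hdeg : q.natDegree < 2 * N := by
    rw [hq, natDegree_pow, natDegree_finsetProd_X_sub_C_eq_card, Finset.card_erase_of_mem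
      (Finset.mem_univ μ), Finset.card_univ, Fintype.card_fin]
    have := μ.pos
    omega
  have h := g.exact q hdeg
  have hz : ∀ j, j ≠ μ → q.eval (g.node j) = 0 := fun j hj => by
    rw [hq, eval_pow, eval_prod, Finset.prod_eq_zero (Finset.mem_erase.2 ⟨hj, Finset.mem_univ j⟩)]
    · simp
    · simp
  rw [Finset.sum_eq_single μ (fun j _ hj => by rw [hz j hj, mul_zero]) (by simp)] at h
  have hpos := integral_eval_pos hq0 fun t _ => by rw [hq, eval_pow]; positivity
  have hnn : 0 ≤ q.eval (g.node μ) := by rw [hq, eval_pow]; positivity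
  by_contra hneg
  push Not at hneg
  nlinarith [mul_nonneg (neg_nonneg.2 hneg) hnn]

namespace GaussLobattoRule

variable {n : ℕ} (gl : GaussLobattoRule n)

/-- The monic polynomial with roots at the interior nodes. -/
def interior : ℝ[X] := ∏ j : Fin n, (X - C (gl.node j.castSucc.succ))

theorem interior_monic : gl.interior.Monic := monic_prod_of_monic _ _ fun _ _ => monic_X_sub_C _

theorem natDegree_interior : gl.interior.natDegree = n := by
  rw [interior, natDegree_finsetProd_X_sub_C_eq_card, Finset.card_univ, Fintype.card_fin]

theorem node_mem_Icc (ν : Fin (n + 2)) : gl.node ν ∈ Set.Icc (-1 : ℝ) 1 := by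
  rw [← gl.node_first, ← gl.node_last]
  exact ⟨gl.strictMono.monotone (Fin.zero_le _), gl.strictMono.monotone (Fin.le_last _)⟩

theorem interior_eval_node (j : Fin n) : gl.interior.eval (gl.node j.castSucc.succ) = 0 := by
  rw [interior, eval_prod]
  exact Finset.prod_eq_zero (Finset.mem_univ j) (by simp)

theorem weight_pos_of_test (ν : Fin (n + 2)) {q : ℝ[X]} (hq0 : q ≠ 0)
    (hdeg : q.natDegree ≤ 2 * n + 1) (hnn : ∀ t ∈ Set.Icc (-1 : ℝ) 1, 0 ≤ q.eval t)
    (hz : ∀ j, j ≠ ν → q.eval (gl.node j) = 0) : 0 < gl.weight ν := by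
  have h := gl.exact q hdeg
  rw [Finset.sum_eq_single ν (fun j _ hj => by rw [hz j hj, mul_zero]) (by simp)] at h
  have hpos := integral_eval_pos hq0 fun t ht => hnn t (Set.Ioc_subset_Icc_self ht)
  have hν := hnn _ (gl.node_mem_Icc ν)
  by_contra hneg
  push Not at hneg
  nlinarith [mul_nonneg (neg_nonneg.2 hneg) hν]

/-- With `w` the interior polynomial, the tests are `(1 - X) w²` and `(1 + X) w²` at the two ends,
and `(1 - X²) p²` at an interior node, where `p` omits that node's factor. All have degree at most
`2n + 1` and are nonnegative on `[-1, 1]`. -/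
theorem weight_pos (ν : Fin (n + 2)) : 0 < gl.weight ν := by
  have hends : ∀ t ∈ Set.Icc (-1 : ℝ) 1, 0 ≤ 1 + t ∧ 0 ≤ 1 - t := fun t ht =>
    ⟨by linarith [ht.1], by linarith [ht.2]⟩
  have hint := gl.interior_monic.ne_zero
  have hp1 : (1 + X : ℝ[X]) ≠ 0 := by rw [add_comm]; exact X_add_C_ne_zero 1
  have hm1 : (1 - X : ℝ[X]) ≠ 0 := by
    rw [← neg_sub]; exact neg_ne_zero.2 (X_sub_C_ne_zero 1)
  have hp1d : (1 + X : ℝ[X]).natDegree ≤ 1 := by compute_degree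
  have hm1d : (1 - X : ℝ[X]).natDegree ≤ 1 := by compute_degree
  have hcases : ∀ j : Fin (n + 2), j = 0 ∨ j = Fin.last (n + 1) ∨ ∃ i : Fin n, j = i.castSucc.succ := by
    intro j
    induction j using Fin.lastCases with
    | last => exact Or.inr (Or.inl rfl)
    | cast j =>
      induction j using Fin.cases with
      | zero => exact Or.inl rfl
      | succ i => exact Or.inr (Or.inr ⟨i, rfl⟩)
  rcases hcases ν with rfl | rfl | ⟨i, rfl⟩
  · apply gl.weight_pos_of_test 0 (q := (1 - X) * gl.interior ^ 2) (mul_ne_zero hm1 (pow_ne_zero _ hint))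
    · refine natDegree_mul_le.trans ?_
      rw [natDegree_pow, natDegree_interior]
      omega
    · intro t ht
      simp only [eval_mul, eval_sub, eval_one, eval_X, eval_pow]
      exact mul_nonneg (hends t ht).2 (sq_nonneg _)
    · intro j hj
      rcases hcases j with rfl | rfl | ⟨i, rfl⟩
      · exact absurd rfl hj
      · simp [gl.node_last]
      · simp [interior_eval_node]
  · apply gl.weight_pos_of_test _ (q := (1 + X) * gl.interior ^ 2) (mul_ne_zero hp1 (pow_ne_zero _ hint))
    · refine natDegree_mul_le.trans ?_
      rw [natDegree_pow, natDegree_interior]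
      omega
    · intro t ht
      simp only [eval_mul, eval_add, eval_one, eval_X, eval_pow]
      exact mul_nonneg (hends t ht).1 (sq_nonneg _)
    · intro j hj
      rcases hcases j with rfl | rfl | ⟨i, rfl⟩
      · simp [gl.node_first]
      · exact absurd rfl hj
      · simp [interior_eval_node]
  · set p : ℝ[X] := ∏ j ∈ Finset.univ.erase i, (X - C (gl.node j.castSucc.succ)) with hp
    apply gl.weight_pos_of_test _ (q := (1 + X) * (1 - X) * p ^ 2)
      (mul_ne_zero (mul_ne_zero hp1 hm1)
        (pow_ne_zero _ (Finset.prod_ne_zero_iff.2 fun j _ => X_sub_C_ne_zero _)))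
    · have hpd : p.natDegree = n - 1 := by
        rw [hp, natDegree_finsetProd_X_sub_C_eq_card, Finset.card_erase_of_mem
          (Finset.mem_univ i), Finset.card_univ, Fintype.card_fin]
      have h1 := natDegree_mul_le (p := (1 + X : ℝ[X])) (q := 1 - X)
      refine natDegree_mul_le.trans ?_
      rw [natDegree_pow, hpd]
      have := i.pos
      omega
    · intro t ht
      simp only [eval_mul, eval_add, eval_sub, eval_one, eval_X, eval_pow]
      exact mul_nonneg (mul_nonneg (hends t ht).1 (hends t ht).2) (sq_nonneg _)
    · intro j hj
      rcases hcases j with rfl | rfl | ⟨l, rfl⟩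
      · simp [gl.node_first]
      · simp [gl.node_last]
      · have hl : l ≠ i := fun h => hj (by rw [h])
        have : p.eval (gl.node l.castSucc.succ) = 0 := by
          rw [hp, eval_prod]
          exact Finset.prod_eq_zero (Finset.mem_erase.2 ⟨hl, Finset.mem_univ l⟩) (by simp)
        simp [this]

/-- The interior polynomial is orthogonal to lower degrees for the weight `1 - t²`. -/
theorem interior_orthogonal {q : ℝ[X]} (hq : q.degree < n) :
    ∫ t in (-1 : ℝ)..1, ((1 + X) * (1 - X) * gl.interior * q).eval t = 0 := by
  by_cases hq0 : q = 0
  · simp [hq0]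
  have hqn : q.natDegree < n := (natDegree_lt_iff_degree_lt hq0).2 hq
  have hp1d : (1 + X : ℝ[X]).natDegree ≤ 1 := by compute_degree
  have hm1d : (1 - X : ℝ[X]).natDegree ≤ 1 := by compute_degree
  have h := gl.exact ((1 + X) * (1 - X) * gl.interior * q) (by
    have h1 := natDegree_mul_le (p := (1 + X : ℝ[X])) (q := 1 - X)
    have h2 := natDegree_mul_le (p := (1 + X : ℝ[X]) * (1 - X)) (q := gl.interior)
    rw [natDegree_interior] at h2
    refine natDegree_mul_le.trans ?_
    omega)
  rw [Finset.sum_eq_zero] at h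
  · linarith
  · intro j _
    induction j using Fin.lastCases with
    | last => simp [gl.node_last]
    | cast j =>
      induction j using Fin.cases with
      | zero => simp [gl.node_first]
      | succ i => rw [← Fin.succ_castSucc, eval_mul, eval_mul, interior_eval_node]; simp

/-- By uniqueness of the monic orthogonal polynomial: `w` and its signed reflection `w'` are both
monic of degree `n`, so their difference has lower degree, is orthogonal to itself for `1 - t²`, and
vanishes. -/
theorem interior_comp_neg : gl.interior.comp (-X) = (-1) ^ n * gl.interior := by
  set w := gl.interior with hw
  set w' : ℝ[X] := (-1) ^ n * w.comp (-X) with hw'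
  have hmw : w.Monic := gl.interior_monic
  have hnw : w.natDegree = n := gl.natDegree_interior
  have hm' : w'.Monic := by
    have := hmw.neg_one_pow_natDegree_mul_comp_neg_X
    rwa [hnw] at this
  have hn' : w'.natDegree = n := by
    rw [hw', ← hnw]
    have : ((-1 : ℝ[X]) ^ w.natDegree) = C ((-1) ^ w.natDegree) := by simp
    rw [this, natDegree_C_mul (by simp), natDegree_comp]
    simp
  have hdeg : (w - w').degree < n := by
    have := degree_sub_lt_left (p := w) (q := w')
      (by rw [degree_eq_natDegree hmw.ne_zero, degree_eq_natDegree hm'.ne_zero, hnw, hn'])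
      hmw.ne_zero (by rw [hmw.leadingCoeff, hm'.leadingCoeff])
    rwa [degree_eq_natDegree hmw.ne_zero, hnw] at this
  set d := w - w' with hd
  have hdegc : (d.comp (-X)).degree < n := by
    by_cases h0 : d = 0
    · rw [h0]; simp
    · have h1 := (natDegree_lt_iff_degree_lt h0).2 hdeg
      refine lt_of_le_of_lt degree_le_natDegree ?_
      rw [natDegree_comp]
      simpa using h1
  have i1 := gl.interior_orthogonal hdeg
  have i2 := gl.interior_orthogonal hdegc
  rw [← hw] at i1 i2
  -- The substitution `t ↦ -t` moves the reflection from `w'` onto `d`, whose degree it preserves.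
  have i3 : ∫ t in (-1 : ℝ)..1, ((1 + X) * (1 - X) * w' * d).eval t = 0 := by
    have hsub := intervalIntegral.integral_comp_neg (a := -1) (b := 1)
      (fun t : ℝ => ((1 + X) * (1 - X) * w * d.comp (-X)).eval t)
    rw [neg_neg, i2] at hsub
    have : ∀ t : ℝ, ((1 + X) * (1 - X) * w' * d).eval t =
        (-1) ^ n * ((1 + X) * (1 - X) * w * d.comp (-X)).eval (-t) := by
      intro t
      simp [hw']
      ring
    simp only [this, intervalIntegral.integral_const_mul, hsub, mul_zero]
  have hd0 : d = 0 := by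
    by_contra hne
    have hp1 : (1 + X : ℝ[X]) ≠ 0 := by rw [add_comm]; exact X_add_C_ne_zero 1
    have hm1 : (1 - X : ℝ[X]) ≠ 0 := by
      rw [← neg_sub]; exact neg_ne_zero.2 (X_sub_C_ne_zero 1)
    have hpos := integral_eval_pos (q := (1 + X) * (1 - X) * d * d)
      (mul_ne_zero (mul_ne_zero (mul_ne_zero hp1 hm1) hne) hne) (by
        intro t ht
        have h1 : 0 ≤ 1 + t := by linarith [ht.1]
        have h2 : 0 ≤ 1 - t := by linarith [ht.2]
        simp only [eval_mul, eval_add, eval_sub, eval_one, eval_X]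
        rw [mul_assoc]
        exact mul_nonneg (mul_nonneg h1 h2) (mul_self_nonneg _))
    have : ∀ t : ℝ, ((1 + X) * (1 - X) * d * d).eval t =
        ((1 + X) * (1 - X) * w * d).eval t - ((1 + X) * (1 - X) * w' * d).eval t := by
      intro t
      rw [← eval_sub]; congr 1; rw [hd]; ring
    simp only [this] at hpos
    rw [intervalIntegral.integral_sub (Polynomial.continuous _ |>.intervalIntegrable _ _)
      (Polynomial.continuous _ |>.intervalIntegrable _ _), i1, i3] at hpos
    simp at hpos
  have hww : w = w' := sub_eq_zero.1 hd0
  calc w.comp (-X) = (-1) ^ n * ((-1) ^ n * w.comp (-X)) := by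
        rw [← mul_assoc, ← mul_pow]; simp
    _ = (-1) ^ n * w := by rw [← hw', ← hww]

/-- Needed because the CFL condition mentions only the first weight. The tests `(1 ± X) w²` have
equal integrals by the parity of `w`, and each sees a single endpoint. -/
theorem weight_last : gl.weight (Fin.last (n + 1)) = gl.weight 0 := by
  have hp1d : (1 + X : ℝ[X]).natDegree ≤ 1 := by compute_degree
  have hm1d : (1 - X : ℝ[X]).natDegree ≤ 1 := by compute_degree
  have hsq : ∀ t : ℝ, gl.interior.eval (-t) ^ 2 = gl.interior.eval t ^ 2 := fun t => by
    have := congrArg (eval t) gl.interior_comp_neg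
    simp at this
    rw [this, mul_pow, ← pow_mul, mul_comm n 2, pow_mul]; simp
  have h1 := gl.exact ((1 + X) * gl.interior ^ 2) (by
    refine natDegree_mul_le.trans ?_
    rw [natDegree_pow, natDegree_interior]
    omega)
  have h2 := gl.exact ((1 - X) * gl.interior ^ 2) (by
    refine natDegree_mul_le.trans ?_
    rw [natDegree_pow, natDegree_interior]
    omega)
  have hI : ∫ t in (-1 : ℝ)..1, ((1 + X) * gl.interior ^ 2).eval t =
      ∫ t in (-1 : ℝ)..1, ((1 - X) * gl.interior ^ 2).eval t := by
    have hsub := intervalIntegral.integral_comp_neg (a := -1) (b := 1)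
      (fun t : ℝ => ((1 - X) * gl.interior ^ 2).eval t)
    rw [neg_neg] at hsub
    rw [← hsub]
    congr 1
    ext t
    simp [hsq]
  rw [hI, ← h2, Fin.sum_univ_castSucc, Fin.sum_univ_succ, Fin.sum_univ_castSucc,
    Fin.sum_univ_succ, Finset.sum_eq_zero, Finset.sum_eq_zero] at h1
  · simp only [Fin.castSucc_zero, gl.node_first, gl.node_last] at h1
    simp [hsq 1] at h1
    have hne : gl.interior.eval 1 ≠ 0 := by
      rw [interior, eval_prod]
      refine Finset.prod_ne_zero_iff.2 fun j _ => ?_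
      have : gl.node j.castSucc.succ < gl.node (Fin.last (n + 1)) :=
        gl.strictMono (by rw [Fin.succ_castSucc]; exact Fin.castSucc_lt_last _)
      rw [gl.node_last] at this
      simp
      linarith
    rcases h1 with h1 | h1
    · exact h1
    · exact absurd h1 hne
  · intro i _; rw [← Fin.succ_castSucc]; simp [interior_eval_node]
  · intro i _; rw [← Fin.succ_castSucc]; simp [interior_eval_node]

end GaussLobattoRule
end MHD
end

/-! ### Compatible functionals, cell averages and the update. -/

noncomputable section
namespace MHD

/-- An affine functional `U ↦ ℓ U + c` that is positive on `G` and compatible with the fluxes and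
the source term, up to a multiple `κ` of the normal magnetic field. -/
structure IsCompatible (eos : ℝ → ℝ → ℝ) (ℓ : State →ₗ[ℝ] ℝ) (c κ : ℝ) : Prop where
  pos : ∀ U ∈ G, 0 < ℓ U + c
  flux_le : ∀ i, ∀ U ∈ G, ∀ V ∈ G,
    ℓ (flux eos i U) - ℓ (flux eos i V) - κ * (magnetic U i - magnetic V i) ≤
      alpha eos i U V * ((ℓ U + c) + (ℓ V + c))
  source_le : ∀ U ∈ G, ∀ ξ : ℝ,
    -(ξ * (ℓ (sourceVec U) + κ)) ≤ |ξ| / √(density U) * (ℓ U + c)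

theorem isCompatible_normalFunctional {eos : ℝ → ℝ → ℝ}
    (heos : ∀ ρ e : ℝ, 0 < ρ → (0 < eos ρ e ↔ 0 < e)) (vs Bs : Fin 3 → ℝ) :
    IsCompatible eos (normalFunctional vs Bs) (dot Bs Bs / 2) (dot vs Bs) where
  pos _ hU := normalFunctional_pos hU vs Bs
  flux_le i _ hU _ hV := flux_estimate heos i hU hV vs Bs
  source_le _ hU ξ := source_estimate hU vs Bs ξ

theorem isCompatible_density {eos : ℝ → ℝ → ℝ}
    (heos : ∀ ρ e : ℝ, 0 < ρ → (0 < eos ρ e ↔ 0 < e)) :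
    IsCompatible eos (LinearMap.proj 0) 0 0 where
  pos U hU := by
    have : 0 < U 0 := hU.1
    simpa using this
  flux_le i U hU V hV := by
    have := density_flux_estimate heos i hU hV
    simpa [density] using this
  source_le U hU ξ := by
    have : 0 < U 0 := hU.1
    simp only [LinearMap.proj_apply, sourceVec, Matrix.cons_val_zero, add_zero, mul_zero, neg_zero]
    positivity

/-- Flux and source contributions of one Gauss point, combined. -/
theorem IsCompatible.flux_add_source_le {eos : ℝ → ℝ → ℝ} {ℓ : State →ₗ[ℝ] ℝ} {c κ : ℝ}
    (h : IsCompatible eos ℓ c κ) (i : Fin 3) {e e' m m' : State}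
    (he : e ∈ G) (he' : e' ∈ G) (hm : m ∈ G) (hm' : m' ∈ G) {a : ℝ}
    (ha : alpha eos i e e' ≤ a)
    (hb : |magnetic m i - magnetic m' i| / (2 * √(density ((1 / 2 : ℝ) • (m' + m)))) ≤ a) :
    (ℓ (flux eos i e) - ℓ (flux eos i e')) +
        (magnetic m i - magnetic m' i) * ℓ (sourceVec ((1 / 2 : ℝ) • (m' + m))) ≤
      a * ((ℓ e + c) + (ℓ e' + c) + ((ℓ m + c) + (ℓ m' + c))) +
        κ * ((magnetic e i - magnetic e' i) - (magnetic m i - magnetic m' i)) := by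
  have hM := half_smul_add_mem_G hm' hm
  have h1 := h.flux_le i e he e' he'
  have h2 := h.source_le _ hM (-(magnetic m i - magnetic m' i))
  have p1 := h.pos e he
  have p2 := h.pos e' he'
  have p3 := h.pos m hm
  have p4 := h.pos m' hm'
  have h3 := mul_le_mul_of_nonneg_right ha (add_pos p1 p2).le
  have h4 := mul_le_mul_of_nonneg_right hb (add_pos p3 p4).le
  -- The affine functional at the mean state is the mean of its two one-sided values; this half
  -- accounts for the factor `2` in the denominator of `β`.
  have hφ : ℓ ((1 / 2 : ℝ) • (m' + m)) + c = ((ℓ m + c) + (ℓ m' + c)) / 2 := by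
    rw [map_smul, map_add, smul_eq_mul]; ring
  rw [hφ, abs_neg] at h2
  have hs : 0 < √(density ((1 / 2 : ℝ) • (m' + m))) := Real.sqrt_pos.2 hM.1
  have h5 : |magnetic m i - magnetic m' i| / √(density ((1 / 2 : ℝ) • (m' + m))) *
      (((ℓ m + c) + (ℓ m' + c)) / 2) = |magnetic m i - magnetic m' i| /
        (2 * √(density ((1 / 2 : ℝ) • (m' + m)))) * ((ℓ m + c) + (ℓ m' + c)) := by
    field_simp
  rw [h5] at h2
  linarith

theorem Mesh.x_add_div_four (M : Mesh) (s t : ℝ) : M.x (s + t / 4) = M.x s + M.Δx / 4 * t := by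
  simp only [Mesh.x]; ring

theorem Mesh.y_add_div_four (M : Mesh) (s t : ℝ) : M.y (s + t / 4) = M.y s + M.Δy / 4 * t := by
  simp only [Mesh.y]; ring

theorem GaussLobattoRule.endpoints_le_sum {n : ℕ} (gl : GaussLobattoRule n) {f : Fin (n + 2) → ℝ}
    (hf : ∀ ν, 0 ≤ f ν) :
    gl.weight 0 * (f 0 + f (Fin.last (n + 1))) ≤ ∑ ν, gl.weight ν * f ν := by
  rw [Fin.sum_univ_castSucc, Fin.sum_univ_succ, gl.weight_last]
  have : 0 ≤ ∑ i : Fin n, gl.weight i.succ.castSucc * f i.succ.castSucc :=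
    Finset.sum_nonneg fun i _ => mul_nonneg (gl.weight_pos _).le (hf _)
  simp only [Fin.castSucc_zero]
  linarith

namespace CellData

variable {K : CellData} {M : Mesh} {k : ℕ} {g : GaussRule (k + 1)} {gl : GaussLobattoRule (k / 2)}

/-- Two different rules are allowed on the axes, so that the same average can be expanded as Lobatto
× Gauss and as Gauss × Lobatto. The `1 / 4` is each quarter's share of the area. -/
theorem otherAverage_eq_sum {ι κ : Type*} [Fintype ι] [Fintype κ] {nx wx : ι → ℝ} {ny wy : κ → ℝ}
    (hx : QuadExact nx wx k) (hy : QuadExact ny wy k)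
    (hdeg : ∀ σ τ l, (K.other σ τ l).totalDegree ≤ k) :
    K.otherAverage M = ∑ σ : Bool, ∑ τ : Bool, ∑ i, ∑ j, (1 / 4 * (wx i * wy j)) •
      (K.other σ τ).at (M.x (K.cx + sgn σ / 4 + nx i / 4)) (M.y (K.cy + sgn τ / 4 + ny j / 4)) := by
  have hΔx := M.Δx_pos
  have hΔy := M.Δy_pos
  ext l
  simp only [otherAverage, Finset.sum_apply, Pi.smul_apply, smul_eq_mul]
  rw [Finset.mul_sum]
  refine Finset.sum_congr rfl fun σ _ => ?_
  rw [Finset.mul_sum]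
  refine Finset.sum_congr rfl fun τ _ => ?_
  have h := hx.integral_prod hy (hdeg σ τ l) (M.x (K.cx + sgn σ / 4)) (M.y (K.cy + sgn τ / 4))
    (show 0 < M.Δx / 4 by positivity) (show 0 < M.Δy / 4 by positivity)
  have e1 : M.x (K.cx + sgn σ / 4 - 1 / 4) = M.x (K.cx + sgn σ / 4) - M.Δx / 4 := by
    simp only [Mesh.x]; ring
  have e2 : M.x (K.cx + sgn σ / 4 + 1 / 4) = M.x (K.cx + sgn σ / 4) + M.Δx / 4 := by
    simp only [Mesh.x]; ring
  have e3 : M.y (K.cy + sgn τ / 4 - 1 / 4) = M.y (K.cy + sgn τ / 4) - M.Δy / 4 := by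
    simp only [Mesh.y]; ring
  have e4 : M.y (K.cy + sgn τ / 4 + 1 / 4) = M.y (K.cy + sgn τ / 4) + M.Δy / 4 := by
    simp only [Mesh.y]; ring
  simp only [PolyState.at, e1, e2, e3, e4]
  rw [h]
  simp only [M.x_add_div_four (K.cx + sgn σ / 4), M.y_add_div_four (K.cy + sgn τ / 4),
    Finset.mul_sum]
  refine Finset.sum_congr rfl fun i _ => Finset.sum_congr rfl fun j _ => ?_
  field_simp
  norm_num

theorem functional_otherAverage {ι κ : Type*} [Fintype ι] [Fintype κ] {nx wx : ι → ℝ}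
    {ny wy : κ → ℝ} (hx : QuadExact nx wx k) (hy : QuadExact ny wy k)
    (hdeg : ∀ σ τ l, (K.other σ τ l).totalDegree ≤ k) (ℓ : State →ₗ[ℝ] ℝ) (c : ℝ) :
    ℓ (K.otherAverage M) + c = ∑ σ : Bool, ∑ τ : Bool, ∑ i, ∑ j, (1 / 4 * (wx i * wy j)) *
      (ℓ ((K.other σ τ).at (M.x (K.cx + sgn σ / 4 + nx i / 4)) (M.y (K.cy + sgn τ / 4 + ny j / 4)))
        + c) := by
  rw [otherAverage_eq_sum hx hy hdeg]
  have hc : ∑ i, ∑ j, 1 / 4 * (wx i * wy j) * c = c / 4 := by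
    have : ∀ i j, 1 / 4 * (wx i * wy j) * c = c / 4 * wx i * wy j := fun i j => by ring
    simp only [this, ← Finset.mul_sum, hy.sum_weight, mul_one, hx.sum_weight]
  simp only [map_sum, map_smul, smul_eq_mul, mul_add, Finset.sum_add_distrib, hc]
  simp only [Fintype.sum_bool]
  ring

/-- In this lemma and the next seven, the extreme Lobatto nodes of each half interval are
identified: one is the cell edge, the other the mid-line. Admissibility at Lobatto points thus
covers every state in the scheme's fluxes and jumps. -/
theorem glx_zero_true : K.glx M gl true 0 = M.x K.cx := by
  rw [glx, gl.node_first]; congr 1; simp [sgn]; ring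

theorem glx_last_true : K.glx M gl true (Fin.last _) = M.x (K.cx + sgn true / 2) := by
  rw [glx, gl.node_last]; congr 1; simp [sgn]; ring

theorem glx_zero_false : K.glx M gl false 0 = M.x (K.cx + sgn false / 2) := by
  rw [glx, gl.node_first]; congr 1; simp [sgn]; ring

theorem glx_last_false : K.glx M gl false (Fin.last _) = M.x K.cx := by
  rw [glx, gl.node_last]; congr 1; simp [sgn]; ring

theorem gly_zero_true : K.gly M gl true 0 = M.y K.cy := by
  rw [gly, gl.node_first]; congr 1; simp [sgn]; ring

theorem gly_last_true : K.gly M gl true (Fin.last _) = M.y (K.cy + sgn true / 2) := by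
  rw [gly, gl.node_last]; congr 1; simp [sgn]; ring

theorem gly_zero_false : K.gly M gl false 0 = M.y (K.cy + sgn false / 2) := by
  rw [gly, gl.node_first]; congr 1; simp [sgn]; ring

theorem gly_last_false : K.gly M gl false (Fin.last _) = M.y K.cy := by
  rw [gly, gl.node_last]; congr 1; simp [sgn]; ring

theorem Admissible.edgeX_mem (h : K.Admissible M g gl) (σ τ : Bool) (μ : Fin (k + 1)) :
    K.edgeX M g σ τ μ ∈ G := by
  cases σ
  · simpa only [edgeX, glx_zero_false] using (h false τ μ 0).2
  · simpa only [edgeX, glx_last_true] using (h true τ μ (Fin.last _)).2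

theorem Admissible.midX_mem (h : K.Admissible M g gl) (σ τ : Bool) (μ : Fin (k + 1)) :
    K.midX M g σ τ μ ∈ G := by
  cases σ
  · simpa only [midX, glx_last_false] using (h false τ μ (Fin.last _)).2
  · simpa only [midX, glx_zero_true] using (h true τ μ 0).2

theorem Admissible.edgeY_mem (h : K.Admissible M g gl) (τ σ : Bool) (μ : Fin (k + 1)) :
    K.edgeY M g τ σ μ ∈ G := by
  cases τ
  · simpa only [edgeY, gly_zero_false] using (h σ false μ 0).1
  · simpa only [edgeY, gly_last_true] using (h σ true μ (Fin.last _)).1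

theorem Admissible.midY_mem (h : K.Admissible M g gl) (τ σ : Bool) (μ : Fin (k + 1)) :
    K.midY M g τ σ μ ∈ G := by
  cases τ
  · simpa only [midY, gly_last_false] using (h σ false μ (Fin.last _)).1
  · simpa only [midY, gly_zero_true] using (h σ true μ 0).1

variable {eos : ℝ → ℝ → ℝ} {ℓ : State →ₗ[ℝ] ℝ} {c κ : ℝ}

/-- The interface values in the `x` direction bound the cell average from below. -/
theorem otherAverage_ge_X (h : K.Admissible M g gl) (hc : IsCompatible eos ℓ c κ)
    (hdeg : ∀ σ τ l, (K.other σ τ l).totalDegree ≤ k) :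
    gl.weight 0 / 4 * (∑ τ : Bool, ∑ μ, g.weight μ *
      ((ℓ (K.edgeX M g true τ μ) + c) + (ℓ (K.edgeX M g false τ μ) + c) +
        ((ℓ (K.midX M g true τ μ) + c) + (ℓ (K.midX M g false τ μ) + c)))) ≤
      ℓ (K.otherAverage M) + c := by
  have hq : ∀ σ τ : Bool, ∑ i, ∑ j, (1 / 4 * (gl.weight i * g.weight j)) *
      (ℓ ((K.other σ τ).at (K.glx M gl σ i) (K.gy M g τ j)) + c) =
      ∑ μ, g.weight μ / 4 * ∑ ν, gl.weight ν *
        (ℓ ((K.other σ τ).at (K.glx M gl σ ν) (K.gy M g τ μ)) + c) := by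
    intro σ τ
    rw [Finset.sum_comm]
    refine Finset.sum_congr rfl fun μ _ => ?_
    rw [Finset.mul_sum]
    exact Finset.sum_congr rfl fun ν _ => by ring
  have hb : ∀ σ τ : Bool, ∑ μ, g.weight μ / 4 * (gl.weight 0 *
      ((ℓ ((K.other σ τ).at (K.glx M gl σ 0) (K.gy M g τ μ)) + c) +
        (ℓ ((K.other σ τ).at (K.glx M gl σ (Fin.last _)) (K.gy M g τ μ)) + c))) ≤
      ∑ i, ∑ j, (1 / 4 * (gl.weight i * g.weight j)) *
      (ℓ ((K.other σ τ).at (K.glx M gl σ i) (K.gy M g τ j)) + c) := by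
    intro σ τ
    rw [hq]
    refine Finset.sum_le_sum fun μ _ => mul_le_mul_of_nonneg_left ?_
      (div_nonneg (g.weight_pos μ).le (by norm_num))
    -- The interior Lobatto values are nonnegative and are dropped, leaving the edge and mid-line
    -- values.
    exact gl.endpoints_le_sum fun ν => (hc.pos _ (h σ τ μ ν).2).le
  rw [functional_otherAverage gl.quadExact g.quadExact hdeg]
  refine le_trans (le_of_eq ?_)
    (Finset.sum_le_sum fun σ _ => Finset.sum_le_sum fun τ _ => hb σ τ)
  rw [Finset.mul_sum]
  refine Eq.trans ?_ Finset.sum_comm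
  refine Finset.sum_congr rfl fun τ _ => ?_
  rw [Fintype.sum_bool, ← Finset.sum_add_distrib, Finset.mul_sum]
  refine Finset.sum_congr rfl fun μ _ => ?_
  rw [glx_zero_true, glx_last_true, glx_zero_false, glx_last_false]
  simp only [edgeX, midX]
  ring

/-- The interface values in the `y` direction bound the cell average from below. -/
theorem otherAverage_ge_Y (h : K.Admissible M g gl) (hc : IsCompatible eos ℓ c κ)
    (hdeg : ∀ σ τ l, (K.other σ τ l).totalDegree ≤ k) :
    gl.weight 0 / 4 * (∑ σ : Bool, ∑ μ, g.weight μ *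
      ((ℓ (K.edgeY M g true σ μ) + c) + (ℓ (K.edgeY M g false σ μ) + c) +
        ((ℓ (K.midY M g true σ μ) + c) + (ℓ (K.midY M g false σ μ) + c)))) ≤
      ℓ (K.otherAverage M) + c := by
  have hb : ∀ σ τ : Bool, ∑ μ, g.weight μ / 4 * (gl.weight 0 *
      ((ℓ ((K.other σ τ).at (K.gx M g σ μ) (K.gly M gl τ 0)) + c) +
        (ℓ ((K.other σ τ).at (K.gx M g σ μ) (K.gly M gl τ (Fin.last _))) + c))) ≤
      ∑ i, ∑ j, (1 / 4 * (g.weight i * gl.weight j)) *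
      (ℓ ((K.other σ τ).at (K.gx M g σ i) (K.gly M gl τ j)) + c) := by
    intro σ τ
    refine Finset.sum_le_sum fun μ _ => ?_
    have h1 := mul_le_mul_of_nonneg_left (gl.endpoints_le_sum (f := fun ν =>
      ℓ ((K.other σ τ).at (K.gx M g σ μ) (K.gly M gl τ ν)) + c)
      fun ν => (hc.pos _ (h σ τ μ ν).1).le) (div_nonneg (g.weight_pos μ).le (by norm_num : (0:ℝ) ≤ 4))
    refine h1.trans (le_of_eq ?_)
    rw [Finset.mul_sum]
    exact Finset.sum_congr rfl fun ν _ => by ring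
  rw [functional_otherAverage g.quadExact gl.quadExact hdeg]
  refine le_trans (le_of_eq ?_)
    (Finset.sum_le_sum fun σ _ => Finset.sum_le_sum fun τ _ => hb σ τ)
  rw [Finset.mul_sum]
  refine Finset.sum_congr rfl fun σ _ => ?_
  rw [Fintype.sum_bool, ← Finset.sum_add_distrib, Finset.mul_sum]
  refine Finset.sum_congr rfl fun μ _ => ?_
  rw [gly_zero_true, gly_last_true, gly_zero_false, gly_last_false]
  simp only [edgeY, midY]
  ring

/-- The discrete divergence of the other mesh's magnetic field, corrected by the jumps on the
mid-lines, vanishes. -/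
theorem discrete_divergence_eq_zero (hdeg : ∀ σ τ l, (K.other σ τ l).totalDegree ≤ k)
    (hdiv : ∀ σ τ, MvPolynomial.pderiv 0 (K.other σ τ 4) + MvPolynomial.pderiv 1 (K.other σ τ 5) = 0) :
    1 / M.Δx * (∑ τ : Bool, ∑ μ, g.weight μ *
      ((magnetic (K.edgeX M g true τ μ) 0 - magnetic (K.edgeX M g false τ μ) 0) -
        (magnetic (K.midX M g true τ μ) 0 - magnetic (K.midX M g false τ μ) 0))) +
    1 / M.Δy * (∑ σ : Bool, ∑ μ, g.weight μ *
      ((magnetic (K.edgeY M g true σ μ) 1 - magnetic (K.edgeY M g false σ μ) 1) -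
        (magnetic (K.midY M g true σ μ) 1 - magnetic (K.midY M g false σ μ) 1))) = 0 := by
  have hΔx := M.Δx_pos
  have hΔy := M.Δy_pos
  have key := fun σ τ => g.quadExact.discrete_divergence (hdeg σ τ 4) (hdeg σ τ 5) (hdiv σ τ)
    (M.x (K.cx + sgn σ / 4)) (M.y (K.cy + sgn τ / 4))
    (show 0 < M.Δx / 4 by positivity) (show 0 < M.Δy / 4 by positivity)
  have a1 : M.x (K.cx + sgn true / 4) + M.Δx / 4 = M.x (K.cx + sgn true / 2) := by
    simp only [Mesh.x, sgn, if_true]; ring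
  have a2 : M.x (K.cx + sgn true / 4) - M.Δx / 4 = M.x K.cx := by
    simp only [Mesh.x, sgn, if_true]; ring
  have a3 : M.x (K.cx + sgn false / 4) + M.Δx / 4 = M.x K.cx := by
    simp [Mesh.x, sgn]; ring
  have a4 : M.x (K.cx + sgn false / 4) - M.Δx / 4 = M.x (K.cx + sgn false / 2) := by
    simp [Mesh.x, sgn]; ring
  have b1 : M.y (K.cy + sgn true / 4) + M.Δy / 4 = M.y (K.cy + sgn true / 2) := by
    simp only [Mesh.y, sgn, if_true]; ring
  have b2 : M.y (K.cy + sgn true / 4) - M.Δy / 4 = M.y K.cy := by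
    simp only [Mesh.y, sgn, if_true]; ring
  have b3 : M.y (K.cy + sgn false / 4) + M.Δy / 4 = M.y K.cy := by
    simp [Mesh.y, sgn]; ring
  have b4 : M.y (K.cy + sgn false / 4) - M.Δy / 4 = M.y (K.cy + sgn false / 2) := by
    simp [Mesh.y, sgn]; ring
  simp only [← Mesh.x_add_div_four, ← Mesh.y_add_div_four] at key
  -- In each direction, upper or right quarters contribute edge minus mid-line and lower or left
  -- quarters mid-line minus edge, so the sum is the edge difference minus the mid-line jump.
  have k1 := key true true
  have k2 := key true false
  have k3 := key false true
  have k4 := key false false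
  simp only [a1, a2, a3, a4, b1, b2, b3, b4] at k1 k2 k3 k4
  have m0 : ∀ (P : PolyState) (x y : ℝ), magnetic (P.at x y) 0 = MvPolynomial.eval ![x, y] (P 4) :=
    fun _ _ _ => rfl
  have m1 : ∀ (P : PolyState) (x y : ℝ), magnetic (P.at x y) 1 = MvPolynomial.eval ![x, y] (P 5) :=
    fun _ _ _ => rfl
  simp only [edgeX, edgeY, midX, midY, m0, m1, gx, gy, Fintype.sum_bool]
  simp only [mul_sub, Finset.sum_sub_distrib] at k1 k2 k3 k4 ⊢
  rw [one_div_div, one_div_div] at k1 k2 k3 k4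
  rw [div_eq_mul_one_div 4 M.Δx, div_eq_mul_one_div 4 M.Δy] at k1 k2 k3 k4
  linarith

theorem functional_update (τmax Δt : ℝ) :
    ℓ (K.update M g eos τmax Δt) = ℓ (K.ownAverage M) + Δt *
      (1 / τmax * (ℓ (K.otherAverage M) - ℓ (K.ownAverage M))
      - 1 / M.Δx * ∑ τ : Bool, ∑ μ, g.weight μ / 2 *
        ((ℓ (flux eos 0 (K.edgeX M g true τ μ)) - ℓ (flux eos 0 (K.edgeX M g false τ μ)))
          + K.jumpX M g τ μ * ℓ (sourceVec (K.meanX M g τ μ)))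
      - 1 / M.Δy * ∑ σ : Bool, ∑ μ, g.weight μ / 2 *
        ((ℓ (flux eos 1 (K.edgeY M g true σ μ)) - ℓ (flux eos 1 (K.edgeY M g false σ μ)))
          + K.jumpY M g σ μ * ℓ (sourceVec (K.meanY M g σ μ)))) := by
  have e : ∀ w j D s : ℝ, w / 2 * (-(j / D) * s) = -(1 / D) * (w / 2 * (j * s)) := fun w j D s => by
    ring
  simp only [update, newOp, stdOp, sourceOp, map_add, map_sub, map_smul, map_sum, smul_eq_mul,
    mul_add (_ / 2 : ℝ), Finset.sum_add_distrib, e, ← Finset.mul_sum]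
  ring

/-- The updated cell average stays positive under every compatible functional. -/
theorem functional_update_pos (h : K.Admissible M g gl) (hc : IsCompatible eos ℓ c κ)
    (hown : K.ownAverage M ∈ G)
    (hdeg : ∀ σ τ l, (K.other σ τ l).totalDegree ≤ k)
    (hdiv : ∀ σ τ, MvPolynomial.pderiv 0 (K.other σ τ 4) + MvPolynomial.pderiv 1 (K.other σ τ 5) = 0)
    {a₁ a₂ Δt τmax : ℝ} (ha₁ : 0 ≤ a₁) (ha₂ : 0 ≤ a₂)
    (hα₁ : ∀ τ μ, alpha eos 0 (K.edgeX M g true τ μ) (K.edgeX M g false τ μ) ≤ a₁)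
    (hα₂ : ∀ σ μ, alpha eos 1 (K.edgeY M g true σ μ) (K.edgeY M g false σ μ) ≤ a₂)
    (hβ₁ : ∀ τ μ, |K.jumpX M g τ μ| / (2 * √(density (K.meanX M g τ μ))) ≤ a₁)
    (hβ₂ : ∀ σ μ, |K.jumpY M g σ μ| / (2 * √(density (K.meanY M g σ μ))) ≤ a₂)
    (hΔt : 0 < Δt) (hτ : 0 < τmax) (hθ1 : Δt / τmax ≤ 1)
    (hCFL : a₁ * Δt / M.Δx + a₂ * Δt / M.Δy < Δt / τmax * gl.weight 0 / 2) :
    0 < ℓ (K.update M g eos τmax Δt) + c := by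
  have hΔx := M.Δx_pos
  have hΔy := M.Δy_pos
  have hX := otherAverage_ge_X h hc hdeg
  have hY := otherAverage_ge_Y h hc hdeg
  have hD := discrete_divergence_eq_zero (M := M) (g := g) hdeg hdiv
  have hu := hc.pos _ hown
  rw [functional_update]
  have hFX : ∑ τ : Bool, ∑ μ, g.weight μ / 2 *
        ((ℓ (flux eos 0 (K.edgeX M g true τ μ)) - ℓ (flux eos 0 (K.edgeX M g false τ μ)))
          + K.jumpX M g τ μ * ℓ (sourceVec (K.meanX M g τ μ))) ≤
      a₁ / 2 * (∑ τ : Bool, ∑ μ, g.weight μ *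
      ((ℓ (K.edgeX M g true τ μ) + c) + (ℓ (K.edgeX M g false τ μ) + c) +
        ((ℓ (K.midX M g true τ μ) + c) + (ℓ (K.midX M g false τ μ) + c)))) +
      κ / 2 * (∑ τ : Bool, ∑ μ, g.weight μ *
      ((magnetic (K.edgeX M g true τ μ) 0 - magnetic (K.edgeX M g false τ μ) 0) -
        (magnetic (K.midX M g true τ μ) 0 - magnetic (K.midX M g false τ μ) 0))) := by
    simp only [Finset.mul_sum, ← Finset.sum_add_distrib]
    refine Finset.sum_le_sum fun τ _ => Finset.sum_le_sum fun μ _ => ?_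
    have := mul_le_mul_of_nonneg_left (hc.flux_add_source_le 0 (h.edgeX_mem true τ μ)
      (h.edgeX_mem false τ μ) (h.midX_mem true τ μ) (h.midX_mem false τ μ) (hα₁ τ μ) (hβ₁ τ μ))
      (show 0 ≤ g.weight μ / 2 from div_nonneg (g.weight_pos μ).le (by norm_num))
    refine le_trans this (le_of_eq ?_)
    ring
  have hFY : ∑ σ : Bool, ∑ μ, g.weight μ / 2 *
        ((ℓ (flux eos 1 (K.edgeY M g true σ μ)) - ℓ (flux eos 1 (K.edgeY M g false σ μ)))
          + K.jumpY M g σ μ * ℓ (sourceVec (K.meanY M g σ μ))) ≤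
      a₂ / 2 * (∑ σ : Bool, ∑ μ, g.weight μ *
      ((ℓ (K.edgeY M g true σ μ) + c) + (ℓ (K.edgeY M g false σ μ) + c) +
        ((ℓ (K.midY M g true σ μ) + c) + (ℓ (K.midY M g false σ μ) + c)))) +
      κ / 2 * (∑ σ : Bool, ∑ μ, g.weight μ *
      ((magnetic (K.edgeY M g true σ μ) 1 - magnetic (K.edgeY M g false σ μ) 1) -
        (magnetic (K.midY M g true σ μ) 1 - magnetic (K.midY M g false σ μ) 1))) := by
    simp only [Finset.mul_sum, ← Finset.sum_add_distrib]
    refine Finset.sum_le_sum fun τ _ => Finset.sum_le_sum fun μ _ => ?_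
    have := mul_le_mul_of_nonneg_left (hc.flux_add_source_le 1 (h.edgeY_mem true τ μ)
      (h.edgeY_mem false τ μ) (h.midY_mem true τ μ) (h.midY_mem false τ μ) (hα₂ τ μ) (hβ₂ τ μ))
      (show 0 ≤ g.weight μ / 2 from div_nonneg (g.weight_pos μ).le (by norm_num))
    refine le_trans this (le_of_eq ?_)
    ring
  have hSX : 0 < ∑ τ : Bool, ∑ μ, g.weight μ *
      ((ℓ (K.edgeX M g true τ μ) + c) + (ℓ (K.edgeX M g false τ μ) + c) +
        ((ℓ (K.midX M g true τ μ) + c) + (ℓ (K.midX M g false τ μ) + c))) := by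
    refine Finset.sum_pos (fun τ _ => Finset.sum_pos (fun μ _ => mul_pos (g.weight_pos μ) ?_)
      Finset.univ_nonempty) Finset.univ_nonempty
    exact add_pos (add_pos (hc.pos _ (h.edgeX_mem _ _ _)) (hc.pos _ (h.edgeX_mem _ _ _)))
      (add_pos (hc.pos _ (h.midX_mem _ _ _)) (hc.pos _ (h.midX_mem _ _ _)))
  have hSY : 0 < ∑ σ : Bool, ∑ μ, g.weight μ *
      ((ℓ (K.edgeY M g true σ μ) + c) + (ℓ (K.edgeY M g false σ μ) + c) +
        ((ℓ (K.midY M g true σ μ) + c) + (ℓ (K.midY M g false σ μ) + c))) := by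
    refine Finset.sum_pos (fun τ _ => Finset.sum_pos (fun μ _ => mul_pos (g.weight_pos μ) ?_)
      Finset.univ_nonempty) Finset.univ_nonempty
    exact add_pos (add_pos (hc.pos _ (h.edgeY_mem _ _ _)) (hc.pos _ (h.edgeY_mem _ _ _)))
      (add_pos (hc.pos _ (h.midY_mem _ _ _)) (hc.pos _ (h.midY_mem _ _ _)))
  generalize (∑ τ : Bool, ∑ μ, g.weight μ *
      ((ℓ (K.edgeX M g true τ μ) + c) + (ℓ (K.edgeX M g false τ μ) + c) +
        ((ℓ (K.midX M g true τ μ) + c) + (ℓ (K.midX M g false τ μ) + c)))) = SX at *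
  generalize (∑ σ : Bool, ∑ μ, g.weight μ *
      ((ℓ (K.edgeY M g true σ μ) + c) + (ℓ (K.edgeY M g false σ μ) + c) +
        ((ℓ (K.midY M g true σ μ) + c) + (ℓ (K.midY M g false σ μ) + c)))) = SY at *
  generalize (∑ τ : Bool, ∑ μ, g.weight μ *
      ((magnetic (K.edgeX M g true τ μ) 0 - magnetic (K.edgeX M g false τ μ) 0) -
        (magnetic (K.midX M g true τ μ) 0 - magnetic (K.midX M g false τ μ) 0))) = DX at *
  generalize (∑ σ : Bool, ∑ μ, g.weight μ *
      ((magnetic (K.edgeY M g true σ μ) 1 - magnetic (K.edgeY M g false σ μ) 1) -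
        (magnetic (K.midY M g true σ μ) 1 - magnetic (K.midY M g false σ μ) 1))) = DY at *
  generalize (∑ τ : Bool, ∑ μ, g.weight μ / 2 *
        ((ℓ (flux eos 0 (K.edgeX M g true τ μ)) - ℓ (flux eos 0 (K.edgeX M g false τ μ)))
          + K.jumpX M g τ μ * ℓ (sourceVec (K.meanX M g τ μ)))) = FX at *
  generalize (∑ σ : Bool, ∑ μ, g.weight μ / 2 *
        ((ℓ (flux eos 1 (K.edgeY M g true σ μ)) - ℓ (flux eos 1 (K.edgeY M g false σ μ)))
          + K.jumpY M g σ μ * ℓ (sourceVec (K.meanY M g σ μ)))) = FY at *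
  generalize ℓ (K.ownAverage M) = u at *
  generalize ℓ (K.otherAverage M) = v at *
  generalize gl.weight 0 = w at *
  set θ := Δt / τmax with hθ
  have hθ0 : 0 < θ := div_pos hΔt hτ
  have hx : 0 ≤ a₁ * Δt / M.Δx := by positivity
  have hy : 0 ≤ a₂ * Δt / M.Δy := by positivity
  -- A convex combination of the two averages with parameter `θ`; `θ ≤ 1` keeps the own average's
  -- coefficient nonnegative.
  have e1 : u + Δt * (1 / τmax * (v - u) - 1 / M.Δx * FX - 1 / M.Δy * FY) + c =
      (1 - θ) * (u + c) + θ * (v + c) - Δt / M.Δx * FX - Δt / M.Δy * FY := by rw [hθ]; ring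
  have f1 := mul_le_mul_of_nonneg_left hFX (show 0 ≤ Δt / M.Δx by positivity)
  have f2 := mul_le_mul_of_nonneg_left hFY (show 0 ≤ Δt / M.Δy by positivity)
  have e2 : Δt / M.Δx * (a₁ / 2 * SX + κ / 2 * DX) + Δt / M.Δy * (a₂ / 2 * SY + κ / 2 * DY) =
      a₁ * Δt / M.Δx * (SX / 2) + a₂ * Δt / M.Δy * (SY / 2)
        + Δt * κ / 2 * (1 / M.Δx * DX + 1 / M.Δy * DY) := by ring
  -- The leftovers of both directions combine into the discrete divergence and disappear; this is
  -- the only coupling between `x` and `y` fluxes.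
  rw [hD, mul_zero, add_zero] at e2
  have hvX := mul_le_mul_of_nonneg_left hX hθ0.le
  have hvY := mul_le_mul_of_nonneg_left hY hθ0.le
  have hu' : 0 ≤ (1 - θ) * (u + c) := mul_nonneg (by linarith) hu.le
  rw [e1]
  generalize a₁ * Δt / M.Δx = lx at *
  generalize a₂ * Δt / M.Δy = ly at *
  -- Both directions are compared with the larger of `SX` and `SY`: the total loss is at most `(lx +
  -- ly) / 2` times it, strictly below `θ w / 4` times it, which the other average supplies through
  -- the expansion in that direction alone.
  rcases le_total SX SY with hle | hle
  · have g1 := mul_le_mul_of_nonneg_left hle hx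
    have g2 := mul_lt_mul_of_pos_right hCFL hSY
    linarith
  · have g1 := mul_le_mul_of_nonneg_left hle hy
    have g2 := mul_lt_mul_of_pos_right hCFL hSX
    linarith

/-- One cell of the scheme: the updated cell average is admissible. -/
theorem update_mem_G (heos : ∀ ρ e : ℝ, 0 < ρ → (0 < eos ρ e ↔ 0 < e))
    (h : K.Admissible M g gl) (hown : K.ownAverage M ∈ G)
    (hdeg : ∀ σ τ l, (K.other σ τ l).totalDegree ≤ k)
    (hdiv : ∀ σ τ, MvPolynomial.pderiv 0 (K.other σ τ 4) + MvPolynomial.pderiv 1 (K.other σ τ 5) = 0)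
    {a₁ a₂ Δt τmax : ℝ} (hα₁ : K.aHatX M g eos ≤ a₁) (hα₂ : K.aHatY M g eos ≤ a₂)
    (hβ₁ : K.betaX M g ≤ a₁) (hβ₂ : K.betaY M g ≤ a₂)
    (hΔt : 0 < Δt) (hτ : 0 < τmax) (hθ1 : Δt / τmax ≤ 1)
    (hCFL : a₁ * Δt / M.Δx + a₂ * Δt / M.Δy < Δt / τmax * gl.weight 0 / 2) :
    K.update M g eos τmax Δt ∈ G := by
  have b1 : ∀ τ μ, alpha eos 0 (K.edgeX M g true τ μ) (K.edgeX M g false τ μ) ≤ a₁ := fun τ μ =>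
    (le_ciSup (f := fun p : Bool × Fin (k + 1) => alpha eos 0 (K.edgeX M g true p.1 p.2)
      (K.edgeX M g false p.1 p.2)) (Set.finite_range _).bddAbove (τ, μ)).trans hα₁
  have b2 : ∀ σ μ, alpha eos 1 (K.edgeY M g true σ μ) (K.edgeY M g false σ μ) ≤ a₂ := fun σ μ =>
    (le_ciSup (f := fun p : Bool × Fin (k + 1) => alpha eos 1 (K.edgeY M g true p.1 p.2)
      (K.edgeY M g false p.1 p.2)) (Set.finite_range _).bddAbove (σ, μ)).trans hα₂
  have b3 : ∀ τ μ, |K.jumpX M g τ μ| / (2 * √(density (K.meanX M g τ μ))) ≤ a₁ := fun τ μ =>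
    (le_ciSup (f := fun p : Bool × Fin (k + 1) => |K.jumpX M g p.1 p.2| /
      (2 * √(density (K.meanX M g p.1 p.2)))) (Set.finite_range _).bddAbove (τ, μ)).trans hβ₁
  have b4 : ∀ σ μ, |K.jumpY M g σ μ| / (2 * √(density (K.meanY M g σ μ))) ≤ a₂ := fun σ μ =>
    (le_ciSup (f := fun p : Bool × Fin (k + 1) => |K.jumpY M g p.1 p.2| /
      (2 * √(density (K.meanY M g p.1 p.2)))) (Set.finite_range _).bddAbove (σ, μ)).trans hβ₂
  -- Nonnegativity comes from the `β` bound at one Gauss point, which exists because `k + 1 ≥ 1`.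
  have ha₁ : 0 ≤ a₁ := le_trans (by positivity) (b3 true 0)
  have ha₂ : 0 ≤ a₂ := le_trans (by positivity) (b4 true 0)
  rw [mem_G_iff]
  constructor
  · have := functional_update_pos h (isCompatible_density heos) hown hdeg hdiv ha₁ ha₂ b1 b2 b3 b4
      hΔt hτ hθ1 hCFL
    rw [add_zero] at this
    exact this
  · intro vs Bs
    exact functional_update_pos h (isCompatible_normalFunctional heos vs Bs) hown hdeg hdiv
      ha₁ ha₂ b1 b2 b3 b4 hΔt hτ hθ1 hCFL

end CellData

theorem le_maxOver_primal {PC DC : Finset (ℤ × ℤ)} {UC UD : ℤ × ℤ → PolyState} {f : CellData → ℝ}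
    {c : ℤ × ℤ} (hc : c ∈ PC) : f (primalCell UC UD c) ≤ maxOver PC DC UC UD f :=
  (le_ciSup (f := fun c : PC => f (primalCell UC UD c)) (Set.finite_range _).bddAbove
    ⟨c, hc⟩).trans (le_max_left _ _)

theorem le_maxOver_dual {PC DC : Finset (ℤ × ℤ)} {UC UD : ℤ × ℤ → PolyState} {f : CellData → ℝ}
    {c : ℤ × ℤ} (hc : c ∈ DC) : f (dualCell UC UD c) ≤ maxOver PC DC UC UD f :=
  (le_ciSup (f := fun c : DC => f (dualCell UC UD c)) (Set.finite_range _).bddAbove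
    ⟨c, hc⟩).trans (le_max_right _ _)

end MHD
end

/-- `PC` and `DC` are the finite sets of primal and dual cells of the computational domain;
`N = k + 1` Gauss points and `L = ⌈(k + 3) / 2⌉ = k / 2 + 2` Gauss–Lobatto points are used on each
half cell; `θ = Δt / τmax`. -/
theorem theorem4p2
    (eos : ℝ → ℝ → ℝ) (heos : ∀ ρ e : ℝ, 0 < ρ → (0 < eos ρ e ↔ 0 < e))
    (M : MHD.Mesh) (k : ℕ) (g : MHD.GaussRule (k + 1)) (gl : MHD.GaussLobattoRule (k / 2))
    (PC DC : Finset (ℤ × ℤ)) (UC UD : ℤ × ℤ → MHD.PolyState)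
    (hUC : MHD.LocallyDF k UC) (hUD : MHD.LocallyDF k UD)
    (havgC : ∀ c ∈ PC, (MHD.primalCell UC UD c).ownAverage M ∈ MHD.G)
    (havgD : ∀ c ∈ DC, (MHD.dualCell UC UD c).ownAverage M ∈ MHD.G)
    (hptD : ∀ c ∈ PC, (MHD.primalCell UC UD c).Admissible M g gl)
    (hptC : ∀ c ∈ DC, (MHD.dualCell UC UD c).Admissible M g gl)
    (Δt τmax θ : ℝ) (hΔt : 0 < Δt) (hτ : 0 < τmax) (hθ : θ = Δt / τmax) (hθ1 : θ ≤ 1)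
    (hCFL : MHD.speedX M g eos PC DC UC UD * Δt / M.Δx + MHD.speedY M g eos PC DC UC UD * Δt / M.Δy
      < θ * gl.weight 0 / 2) :
    (∀ c ∈ PC, (MHD.primalCell UC UD c).update M g eos τmax Δt ∈ MHD.G) ∧
    (∀ c ∈ DC, (MHD.dualCell UC UD c).update M g eos τmax Δt ∈ MHD.G) := by
  subst hθ
  constructor
  · intro c hc
    refine MHD.CellData.update_mem_G heos (hptD c hc) (havgC c hc) (fun σ τ => (hUD _).1)
      (fun σ τ => (hUD _).2) ?_ ?_ ?_ ?_ hΔt hτ hθ1 hCFL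
    · exact (MHD.le_maxOver_primal (f := fun K => K.aHatX M g eos) hc).trans (le_max_left _ _)
    · exact (MHD.le_maxOver_primal (f := fun K => K.aHatY M g eos) hc).trans (le_max_left _ _)
    · exact (MHD.le_maxOver_primal (f := fun K => K.betaX M g) hc).trans (le_max_right _ _)
    · exact (MHD.le_maxOver_primal (f := fun K => K.betaY M g) hc).trans (le_max_right _ _)
  · intro c hc
    refine MHD.CellData.update_mem_G heos (hptC c hc) (havgD c hc) (fun σ τ => (hUC _).1)
      (fun σ τ => (hUC _).2) ?_ ?_ ?_ ?_ hΔt hτ hθ1 hCFL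
    · exact (MHD.le_maxOver_dual (f := fun K => K.aHatX M g eos) hc).trans (le_max_left _ _)
    · exact (MHD.le_maxOver_dual (f := fun K => K.aHatY M g eos) hc).trans (le_max_left _ _)
    · exact (MHD.le_maxOver_dual (f := fun K => K.betaX M g) hc).trans (le_max_right _ _)
    · exact (MHD.le_maxOver_dual (f := fun K => K.betaY M g) hc).trans (le_max_right _ _)
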